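/- For a Polish group $H$, a pair $(g,h)\in H^2$ \emph{cyclically generates} $H$ if $\{g^l h g^{-l} : l\in\mathbb{Z}\}$ is dense in $H$; in that case $H$ has a \emph{cyclically dense conjugacy class}. For a Polish group $G$, let $L_0(G)$ be the group, under pointwise multiplication, of classes (modulo equality almost everywhere) of Lebesgue measurable functions $[0,1]\to G$, with the topology of convergence in measure; for $g\in G$ let $f_g\in L_0(G)$ be the constant function with value $g$. Powers $G^n$ carry the product topology. Let $G$ be one of the following Polish groups, and let $g\in G$ be the indicated element: (1) $G=S_\infty$, the group of all permutations of $\mathbb{Z}$ with the topology of pointwise convergence ($\mathbb{Z}$ discrete), and $g$ is the shift $n\mapsto n+1$; (2) $G=\mathrm{Aut}(\mathbb{Q},<)$, the group of order automorphisms of $\mathbb{Q}$ with the topology of pointwise convergence ($\mathbb{Q}$ discrete), and $g$ is a shift $x\mapsto x+q$, where $q$ is any nonzero rational number; (3) $G=H(2^{\mathbb{Z}})$, the group of homeomorphisms of the Cantor space $2^{\mathbb{Z}}=\{0,1\}^{\mathbb{Z}}$ with the compact-open topology, and $g$ is the Bernoulli shift $(x_n)_n\mapsto(x_{n+1})_n$;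 (4) $G=H(2^{\mathbb{Z}},\mu^{\mathbb{Z}})$, the subgroup of $H(2^{\mathbb{Z}})$, with the subspace topology, of the homeomorphisms that preserve the product measure $\mu^{\mathbb{Z}}$, where $\mu(\{0\})=\mu(\{1\})=\tfrac12$, and $g$ is again the Bernoulli shift. Then for every integer $n\ge 1$ the group $G^n$, and also the group $L_0(G)$, has a cyclically dense conjugacy class. In fact, for every $n\ge1$ there is $\bar b\in G^n$ such that the pair $((g,\dots,g),\bar b)$ cyclically generates $G^n$ and freely generates a free group of rank $2$; and there is $b\in L_0(G)$ such that the pair $(f_g,b)$ cyclically generates $L_0(G)$ and freely generates a free group of rank $2$. -/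

import Mathlib

open MeasureTheory Topology Set

noncomputable section

/-! ### Cyclic generation -/

/-- `(g, h)` (topologically) cyclically generates `H`: the set `{g ^ l * h * g ^ (-l) : l ∈ ℤ}`
is dense in `H`. -/
def CyclicallyGenerates {H : Type*} [Group H] [TopologicalSpace H] (g h : H) : Prop :=
  Dense {x : H | ∃ l : ℤ, x = g ^ l * h * g ^ (-l)}

/-- `H` has a cyclically dense conjugacy class. -/
def HasCyclicallyDenseConjClass (H : Type*) [Group H] [TopologicalSpace H] : Prop :=
  ∃ g h : H, CyclicallyGenerates g h

/-- The pair `(g, h)` generates a free group, freely: the canonical homomorphism from the free group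
on two letters that sends the letters to `g` and `h` is injective. -/
def GeneratesFreeGroup {H : Type*} [Group H] (g h : H) : Prop :=
  Function.Injective (FreeGroup.lift ![g, h])

/-! ### The group `L₀(G)` -/

/-- `L₀(G)`: classes, modulo equality almost everywhere with respect to Lebesgue measure, of
measurable functions from `[0,1]` to `G`. -/
def L0 (G : Type*) [TopologicalSpace G] : Type _ := unitInterval →ₘ[volume] G

/-- Elements of `L₀(G)` are regarded as functions, through a measurable representative. -/
instance (G : Type*) [TopologicalSpace G] : CoeFun (L0 G) fun _ => unitInterval → G :=
  inferInstanceAs (CoeFun (unitInterval →ₘ[volume] G) fun _ => unitInterval → G)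

/-- The group structure of `L₀(G)` is pointwise multiplication. -/
instance (G : Type*) [TopologicalSpace G] [Group G] [IsTopologicalGroup G] : Group (L0 G) :=
  inferInstanceAs (Group (unitInterval →ₘ[volume] G))

/-- The class in `L₀(G)` of the constant function with value `g`. -/
def L0.const {G : Type*} [TopologicalSpace G] (g : G) : L0 G :=
  AEEqFun.const unitInterval g

/-- The set `[h, δ, ε]` of those `f` in `L₀(Y)` with `vol {x | d (f x, h x) < δ} > 1 - ε`, where `d`
is a fixed complete metric on the Polish space `Y`, compatible with its topology. -/
def L0.nhd {Y : Type*} [TopologicalSpace Y] [PolishSpace Y] (h : L0 Y) (δ ε : ℝ) : Set (L0 Y) :=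
  letI := TopologicalSpace.upgradeIsCompletelyMetrizable Y
  {f | 1 - ε < (volume : Measure unitInterval).real
    {x | dist (f x) (h x) < δ}}

theorem L0.nhd_mono {Y : Type*} [TopologicalSpace Y] [PolishSpace Y] (h : L0 Y) {δ δ' ε ε' : ℝ}
    (hδ : δ ≤ δ') (hε : ε ≤ ε') : L0.nhd h δ ε ⊆ L0.nhd h δ' ε' := fun _ hf =>
  lt_of_le_of_lt (sub_le_sub_left hε _) <|
    lt_of_lt_of_le hf <| measureReal_mono fun _ hx => lt_of_lt_of_le hx hδ

/-- The topology of convergence in measure. -/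
instance (Y : Type*) [TopologicalSpace Y] [PolishSpace Y] : TopologicalSpace (L0 Y) where
  IsOpen U := ∀ h ∈ U, ∃ δ > 0, ∃ ε > 0, L0.nhd h δ ε ⊆ U
  isOpen_univ := fun _ _ => ⟨1, one_pos, 1, one_pos, subset_univ _⟩
  isOpen_inter := by
    rintro s t hs ht h ⟨h1, h2⟩
    obtain ⟨δ, hδ, ε, hε, H⟩ := hs h h1
    obtain ⟨δ', hδ', ε', hε', H'⟩ := ht h h2
    exact ⟨min δ δ', lt_min hδ hδ', min ε ε', lt_min hε hε', subset_inter
      ((L0.nhd_mono h (min_le_left _ _) (min_le_left _ _)).trans H)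
      ((L0.nhd_mono h (min_le_right _ _) (min_le_right _ _)).trans H')⟩
  isOpen_sUnion := by
    rintro S hS h ⟨s, hs, hhs⟩
    obtain ⟨δ, hδ, ε, hε, H⟩ := hS s hs h hhs
    exact ⟨δ, hδ, ε, hε, H.trans (subset_sUnion_of_mem hs)⟩

theorem L0.mem_nhd_self {Y : Type*} [TopologicalSpace Y] [PolishSpace Y] (h : L0 Y) {δ ε : ℝ}
    (hδ : 0 < δ) (hε : 0 < ε) : h ∈ L0.nhd h δ ε := by
  simp [L0.nhd, hδ, hε]

/-- The sets `[h, δ, ε]` are open in the topology above. -/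
theorem L0.isOpen_nhd {Y : Type*} [TopologicalSpace Y] [PolishSpace Y] (h : L0 Y) (δ ε : ℝ) :
    IsOpen (L0.nhd h δ ε) := by
  let _ := TopologicalSpace.upgradeIsCompletelyMetrizable Y
  intro g hg
  change 1 - ε < (volume : Measure unitInterval).real
    {x | dist (g x) (h x) < δ} at hg
  set A : ℕ → Set unitInterval := fun n =>
    {x | dist (g x) (h x)
      < δ - 1 / ((n : ℝ) + 1)} with hA
  have hmono : Monotone A := by
    intro m n hmn x hx
    have := Nat.one_div_le_one_div (α := ℝ) hmn
    simp only [hA, mem_ofPred_eq] at hx ⊢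
    linarith
  have hU : (⋃ n, A n) = {x | dist (g x)
      (h x) < δ} := by
    ext x
    simp only [hA, mem_iUnion, mem_ofPred_eq]
    constructor
    · rintro ⟨n, hn⟩
      have := Nat.one_div_pos_of_nat (α := ℝ) (n := n)
      linarith
    · intro hx
      obtain ⟨n, hn⟩ := exists_nat_one_div_lt (sub_pos.2 hx)
      exact ⟨n, by linarith⟩
  have hT := tendsto_measure_iUnion_atTop (μ := (volume : Measure unitInterval)) hmono
  have hT' := (ENNReal.tendsto_toReal (measure_ne_top _ _)).comp hT
  rw [hU] at hT'
  obtain ⟨n, hn⟩ := (hT'.eventually (lt_mem_nhds hg)).exists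
  refine ⟨1 / ((n : ℝ) + 1), Nat.one_div_pos_of_nat, volume.real (A n) - (1 - ε),
    sub_pos.2 hn, fun f hf => ?_⟩
  change _ < volume.real _ at hf
  change _ < volume.real _
  set B : Set unitInterval := {x | dist (f x)
    (g x) < 1 / ((n : ℝ) + 1)} with hB
  set C : Set unitInterval := {x | dist (f x)
    (h x) < δ} with hC
  have hmA : MeasurableSet (A n) := by
    have : Measurable fun x => dist (g x)
        (h x) :=
      (AEEqFun.stronglyMeasurable (g : unitInterval →ₘ[volume] Y)).dist
        (AEEqFun.stronglyMeasurable (h : unitInterval →ₘ[volume] Y)) |>.measurable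
    exact measurableSet_lt this measurable_const
  have hsub : A n ∩ B ⊆ C := by
    rintro x ⟨h1, h2⟩
    simp only [hA, hB, hC, mem_ofPred_eq] at h1 h2 ⊢
    have := dist_triangle (f x)
      (g x) (h x)
    linarith
  have h1 := measureReal_union_add_inter' (μ := (volume : Measure unitInterval)) (t := B) hmA
  have h2 : volume.real (A n ∪ B) ≤ 1 := measureReal_le_one
  have h3 : volume.real (A n ∩ B) ≤ volume.real C := measureReal_mono hsub
  linarith

/-- For every `h`, the sets `[h, δ, ε]` with `δ, ε > 0` form a neighbourhood basis at `h`. -/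
theorem L0.hasBasis_nhds {Y : Type*} [TopologicalSpace Y] [PolishSpace Y] (h : L0 Y) :
    (𝓝 h).HasBasis (fun p : ℝ × ℝ => 0 < p.1 ∧ 0 < p.2) fun p => L0.nhd h p.1 p.2 := by
  refine ⟨fun U => ?_⟩
  rw [mem_nhds_iff]
  constructor
  · rintro ⟨V, hVU, hV, hhV⟩
    obtain ⟨δ, hδ, ε, hε, H⟩ := hV h hhV
    exact ⟨(δ, ε), ⟨hδ, hε⟩, H.trans hVU⟩
  · rintro ⟨⟨δ, ε⟩, ⟨hδ, hε⟩, H⟩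
    exact ⟨_, H, L0.isOpen_nhd h δ ε, L0.mem_nhd_self h hδ hε⟩

/-! ### Permutation groups -/

/-- The topology of pointwise convergence on the group of permutations of a set `M`, with `M`
discrete. -/
instance (M : Type*) : TopologicalSpace (Equiv.Perm M) :=
  TopologicalSpace.induced (fun (σ : Equiv.Perm M) (x : M) => σ x)
    (@Pi.topologicalSpace M (fun _ => M) fun _ => ⊥)

theorem Equiv.Perm.continuous_of_isOpen {M T : Type*} [TopologicalSpace T]
    {F : T → Equiv.Perm M} (hF : ∀ x y : M, IsOpen {t | F t x = y}) : Continuous F := by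
  let _ : TopologicalSpace M := ⊥
  have _ : DiscreteTopology M := ⟨rfl⟩
  exact continuous_induced_rng.2 <| continuous_pi fun x => continuous_discrete_rng.2 (hF x)

theorem Equiv.Perm.isOpen_apply_eq {M : Type*} (x y : M) :
    IsOpen {σ : Equiv.Perm M | σ x = y} := by
  let _ : TopologicalSpace M := ⊥
  have _ : DiscreteTopology M := ⟨rfl⟩
  have h : Continuous fun (σ : Equiv.Perm M) (x : M) => σ x := continuous_induced_dom
  exact (isOpen_discrete {y}).preimage ((continuous_apply x).comp h)

instance (M : Type*) : IsTopologicalGroup (Equiv.Perm M) where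
  continuous_mul := by
    refine Equiv.Perm.continuous_of_isOpen fun x y => ?_
    have : {t : Equiv.Perm M × Equiv.Perm M | (t.1 * t.2) x = y} =
        ⋃ z, {σ : Equiv.Perm M | σ z = y} ×ˢ {σ : Equiv.Perm M | σ x = z} := by
      ext t; simp
    rw [this]
    exact isOpen_iUnion fun z =>
      (Equiv.Perm.isOpen_apply_eq z y).prod (Equiv.Perm.isOpen_apply_eq x z)
  continuous_inv := by
    refine Equiv.Perm.continuous_of_isOpen fun x y => ?_
    have : {σ : Equiv.Perm M | σ⁻¹ x = y} = {σ : Equiv.Perm M | σ y = x} := by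
      ext σ; exact Equiv.Perm.inv_eq_iff_eq.trans eq_comm
    rw [this]
    exact Equiv.Perm.isOpen_apply_eq y x

instance (M : Type*) [Countable M] : PolishSpace (Equiv.Perm M) := by
  let _ : TopologicalSpace M := ⊥
  have _ : DiscreteTopology M := ⟨rfl⟩
  have hval : Continuous fun (σ : Equiv.Perm M) (x : M) => σ x := continuous_induced_dom
  let F : Equiv.Perm M → (M → M) × (M → M) := fun σ => (fun x => σ x, fun x => σ⁻¹ x)
  have hFc : Continuous F := hval.prodMk (hval.comp continuous_inv)
  have hFi : IsInducing F :=
    IsInducing.of_comp hFc continuous_fst ⟨rfl⟩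
  have hFinj : Function.Injective F := fun σ τ h =>
    Equiv.ext fun x => congrFun (congrArg Prod.fst h) x
  have hcl : IsClosed (range F) := by
    have hr : range F = ⋂ x : M, ⋂ y : M,
        ({p : (M → M) × (M → M) | p.2 x = y}ᶜ ∪ {p | p.1 y = x}) ∩
          ({p : (M → M) × (M → M) | p.1 x = y}ᶜ ∪ {p | p.2 y = x}) := by
      ext p
      constructor
      · rintro ⟨σ, rfl⟩
        simp only [mem_iInter, mem_inter_iff, mem_union, mem_compl_iff, mem_ofPred_eq, F]
        refine fun x y => ⟨?_, ?_⟩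
        · by_cases h : σ⁻¹ x = y
          · right; rw [← h]; simp
          · exact Or.inl h
        · by_cases h : σ x = y
          · right; rw [← h]; simp
          · exact Or.inl h
      · intro h
        simp only [mem_iInter, mem_inter_iff, mem_union, mem_compl_iff, mem_ofPred_eq] at h
        refine ⟨⟨p.1, p.2, fun x => ?_, fun x => ?_⟩, rfl⟩
        · exact (h x (p.1 x)).2.resolve_left fun hn => hn rfl
        · exact (h x (p.2 x)).1.resolve_left fun hn => hn rfl
    rw [hr]
    have h1 : ∀ x y : M, IsClopen {p : (M → M) × (M → M) | p.1 x = y} := fun x y =>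
      (isClopen_discrete {y}).preimage ((continuous_apply x).comp continuous_fst)
    have h2 : ∀ x y : M, IsClopen {p : (M → M) × (M → M) | p.2 x = y} := fun x y =>
      (isClopen_discrete {y}).preimage ((continuous_apply x).comp continuous_snd)
    exact isClosed_iInter fun x => isClosed_iInter fun y =>
      (((h2 x y).compl.isClosed).union (h1 y x).isClosed).inter
        (((h1 x y).compl.isClosed).union (h2 y x).isClosed)
  have : PolishSpace (M → M) :=
    { toSecondCountableTopology := inferInstance, toIsCompletelyMetrizableSpace := inferInstance }
  have : PolishSpace ((M → M) × (M → M)) :=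
    { toSecondCountableTopology := inferInstance, toIsCompletelyMetrizableSpace := inferInstance }
  exact (IsClosedEmbedding.mk ⟨hFi, hFinj⟩ hcl).polishSpace

/-- The topology of pointwise convergence on `Aut(ℚ, <)`, with `ℚ` discrete. -/
instance : TopologicalSpace (ℚ ≃o ℚ) :=
  TopologicalSpace.induced (fun f => (f.toEquiv : Equiv.Perm ℚ)) inferInstance

instance : IsTopologicalGroup (ℚ ≃o ℚ) :=
  topologicalGroup_induced
    (MonoidHom.mk' (fun f : ℚ ≃o ℚ => (f.toEquiv : Equiv.Perm ℚ)) fun _ _ => rfl)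

instance : PolishSpace (ℚ ≃o ℚ) := by
  let F : (ℚ ≃o ℚ) → Equiv.Perm ℚ := fun f => f.toEquiv
  have hF : Function.Injective F := fun f g h => RelIso.toEquiv_injective h
  have hcl : IsClosed (range F) := by
    have hr : range F = ⋂ x : ℚ, ⋂ y : ℚ, ⋂ a : ℚ, ⋂ b : ℚ,
        {σ : Equiv.Perm ℚ | σ x = a}ᶜ ∪ {σ : Equiv.Perm ℚ | σ y = b}ᶜ ∪ {_σ | a ≤ b ↔ x ≤ y} := by
      ext σ
      simp only [mem_iInter, mem_union, mem_compl_iff, mem_ofPred_eq]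
      constructor
      · rintro ⟨f, rfl⟩ x y a b
        by_cases h1 : F f x = a
        · by_cases h2 : F f y = b
          · right; subst h1 h2; exact f.le_iff_le
          · exact Or.inl (Or.inr h2)
        · exact Or.inl (Or.inl h1)
      · intro h
        refine ⟨⟨σ, fun {x y} => ?_⟩, rfl⟩
        have := h x y (σ x) (σ y)
        simpa using this
    rw [hr]
    exact isClosed_iInter fun x => isClosed_iInter fun y => isClosed_iInter fun a =>
      isClosed_iInter fun b =>
        (((Equiv.Perm.isOpen_apply_eq x a).isClosed_compl).union
          (Equiv.Perm.isOpen_apply_eq y b).isClosed_compl).union isClosed_const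
  exact (IsClosedEmbedding.mk ⟨⟨rfl⟩, hF⟩ hcl).polishSpace

/-! ### Homeomorphism groups -/

/-- The compact-open topology on the homeomorphism group of a space; for compact metrizable `X` it
is the topology of uniform convergence. -/
instance (X : Type*) [TopologicalSpace X] : TopologicalSpace (X ≃ₜ X) :=
  TopologicalSpace.induced (fun h => (h : C(X, X))) inferInstance

theorem Homeomorph.continuous_toContinuousMap (X : Type*) [TopologicalSpace X] :
    Continuous fun h : X ≃ₜ X => (h : C(X, X)) := continuous_induced_dom

instance (X : Type*) [TopologicalSpace X] [CompactSpace X] [T2Space X] :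
    IsTopologicalGroup (X ≃ₜ X) where
  continuous_mul := by
    refine continuous_induced_rng.2 ?_
    exact ((Homeomorph.continuous_toContinuousMap X).comp continuous_fst).compCM
      ((Homeomorph.continuous_toContinuousMap X).comp continuous_snd)
  continuous_inv := by
    refine continuous_induced_rng.2 (ContinuousMap.continuous_compactOpen.2 fun K hK U hU => ?_)
    have : {h : X ≃ₜ X | MapsTo (((h⁻¹ : X ≃ₜ X) : C(X, X))) K U} =
        {h : X ≃ₜ X | MapsTo ((h : C(X, X))) Uᶜ Kᶜ} := by
      ext h
      constructor
      · intro H x hx hK'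
        apply hx
        have := H hK'
        simpa using this
      · intro H x hx
        by_contra hU'
        apply H hU'
        simpa using hx
    change IsOpen {h : X ≃ₜ X | MapsTo (((h⁻¹ : X ≃ₜ X) : C(X, X))) K U}
    rw [this]
    exact (ContinuousMap.isOpen_setOfPred_mapsTo hU.isClosed_compl.isCompact
      hK.isClosed.isOpen_compl).preimage (Homeomorph.continuous_toContinuousMap X)

instance (X : Type*) [TopologicalSpace X] [CompactSpace X] [PolishSpace X] :
    PolishSpace (X ≃ₜ X) := by
  have : PolishSpace C(X, X) := by
    let _ := TopologicalSpace.upgradeIsCompletelyMetrizable X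
    infer_instance
  let F : (X ≃ₜ X) → C(X, X) × C(X, X) := fun h => (h, (h⁻¹ : X ≃ₜ X))
  have hval := Homeomorph.continuous_toContinuousMap X
  have hFc : Continuous F := hval.prodMk (hval.comp continuous_inv)
  have hFi : IsInducing F := IsInducing.of_comp hFc continuous_fst ⟨rfl⟩
  have hFinj : Function.Injective F := fun g h H =>
    Homeomorph.ext fun x => DFunLike.congr_fun (congrArg Prod.fst H) x
  have hcl : IsClosed (range F) := by
    have hr : range F = {p | p.1.comp p.2 = ContinuousMap.id X} ∩
        {p | p.2.comp p.1 = ContinuousMap.id X} := by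
      ext p
      constructor
      · rintro ⟨h, rfl⟩
        exact ⟨ContinuousMap.ext fun x => h.apply_symm_apply x,
          ContinuousMap.ext fun x => h.symm_apply_apply x⟩
      · rintro ⟨h1, h2⟩
        exact ⟨⟨⟨p.1, p.2, fun x => DFunLike.congr_fun h2 x, fun x => DFunLike.congr_fun h1 x⟩,
          p.1.continuous, p.2.continuous⟩, rfl⟩
    rw [hr]
    exact (isClosed_eq (continuous_fst.compCM continuous_snd) continuous_const).inter
      (isClosed_eq (continuous_snd.compCM continuous_fst) continuous_const)
  exact (IsClosedEmbedding.mk ⟨hFi, hFinj⟩ hcl).polishSpace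

/-- The Cantor space `2 ^ ℤ`. -/
abbrev CantorZ : Type := ℤ → Bool

instance : PolishSpace CantorZ :=
  { toSecondCountableTopology := inferInstance, toIsCompletelyMetrizableSpace := inferInstance }

/-- The measure on `{0, 1}` that assigns `1 / 2` to each of `0` and `1`. -/
def coinMeasure : Measure Bool :=
  (2⁻¹ : ENNReal) • Measure.dirac false + (2⁻¹ : ENNReal) • Measure.dirac true

instance : IsProbabilityMeasure coinMeasure :=
  ⟨by simp [coinMeasure, ENNReal.inv_two_add_inv_two]⟩

/-- The product measure `μ ^ ℤ` on `2 ^ ℤ`. -/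
def bernoulliMeasure : Measure CantorZ := Measure.infinitePi fun _ : ℤ => coinMeasure

instance : IsProbabilityMeasure bernoulliMeasure := by
  unfold bernoulliMeasure; infer_instance

/-- `H(2 ^ ℤ, μ ^ ℤ)`: the group of homeomorphisms of `2 ^ ℤ` that preserve `μ ^ ℤ`, with the
topology of `H(2 ^ ℤ)`. -/
def measurePreservingHomeo : Subgroup (CantorZ ≃ₜ CantorZ) where
  carrier := {h | MeasurePreserving h bernoulliMeasure bernoulliMeasure}
  mul_mem' {_ _} ha hb := ha.comp hb
  one_mem' := MeasurePreserving.id _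
  inv_mem' {h} hh := MeasurePreserving.symm h.toMeasurableEquiv hh

instance : PolishSpace measurePreservingHomeo := by
  have hcl : IsClosed (measurePreservingHomeo : Set (CantorZ ≃ₜ CantorZ)) := by
    have hr : (measurePreservingHomeo : Set (CantorZ ≃ₜ CantorZ)) =
        ⋂ f : C(CantorZ, ℝ), {h | ∫ x, f (h x) ∂bernoulliMeasure = ∫ x, f x ∂bernoulliMeasure} := by
      ext h
      simp only [mem_iInter, mem_ofPred_eq]
      constructor
      · intro hh f
        exact MeasurePreserving.integral_comp hh h.measurableEmbedding f
      · intro H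
        refine ⟨h.continuous.measurable, ?_⟩
        have : IsProbabilityMeasure (bernoulliMeasure.map h) :=
          Measure.isProbabilityMeasure_map h.continuous.aemeasurable
        refine ext_of_forall_integral_eq_of_IsFiniteMeasure fun f => ?_
        rw [integral_map h.continuous.aemeasurable f.continuous.aestronglyMeasurable]
        exact H f.toContinuousMap
    rw [hr]
    refine isClosed_iInter fun f => isClosed_eq ?_ continuous_const
    have h1 : Continuous fun h : CantorZ ≃ₜ CantorZ => f.comp (h : C(CantorZ, CantorZ)) :=
      continuous_const.compCM (Homeomorph.continuous_toContinuousMap _)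
    have h2 : Continuous fun g : C(CantorZ, ℝ) => ∫ x, g x ∂bernoulliMeasure := by
      have : (fun g : C(CantorZ, ℝ) => ∫ x, g x ∂bernoulliMeasure) =
          fun g => ∫ x, ContinuousMap.toLp (E := ℝ) 1 bernoulliMeasure ℝ g x
            ∂bernoulliMeasure := by
        funext g
        exact (integral_congr_ae (ContinuousMap.coeFn_toLp bernoulliMeasure (𝕜 := ℝ) g)).symm
      rw [this]
      exact continuous_integral.comp (ContinuousMap.toLp (E := ℝ) 1 bernoulliMeasure ℝ).continuous
    exact h2.comp h1
  exact hcl.polishSpace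

/-! ### The shifts -/

/-- The shift `n ↦ n + 1` of `ℤ`. -/
def intShift : Equiv.Perm ℤ := Equiv.addRight 1

/-- The shift `x ↦ x + q` of `ℚ`. -/
def ratShift (q : ℚ) : ℚ ≃o ℚ := OrderIso.addRight q

/-- The Bernoulli shift of `2 ^ ℤ`: `(x n)ₙ ↦ (x (n + 1))ₙ`. -/
def bernoulliShift : CantorZ ≃ₜ CantorZ where
  toFun x n := x (n + 1)
  invFun x n := x (n - 1)
  left_inv x := by funext n; simp
  right_inv x := by funext n; simp
  continuous_toFun := continuous_pi fun n => continuous_apply (n + 1)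
  continuous_invFun := continuous_pi fun n => continuous_apply (n - 1)

theorem bernoulliShift_mem : bernoulliShift ∈ measurePreservingHomeo := by
  refine ⟨bernoulliShift.continuous.measurable, ?_⟩
  refine Measure.eq_infinitePi _ fun s t ht => ?_
  have hm : MeasurableSet (Set.pi (s : Set ℤ) t) :=
    MeasurableSet.pi s.countable_toSet fun i _ => ht i
  have hpre : bernoulliShift ⁻¹' (Set.pi (s : Set ℤ) t) =
      Set.pi ((s.map (Equiv.addRight (1 : ℤ)).toEmbedding : Finset ℤ) : Set ℤ)
        fun i => t (i - 1) := by
    ext x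
    simp only [mem_preimage, Set.mem_pi, bernoulliShift, Finset.coe_map, mem_image]
    constructor
    · rintro h _ ⟨j, hj, rfl⟩
      simpa using h j hj
    · intro h j hj
      simpa using h (j + 1) ⟨j, hj, rfl⟩
  rw [Measure.map_apply bernoulliShift.continuous.measurable hm, hpre, bernoulliMeasure,
    Measure.infinitePi_pi _ fun i _ => ht (i - 1)]
  simp

/-- The Bernoulli shift as an element of `H(2 ^ ℤ, μ ^ ℤ)`. -/
def bernoulliShiftMP : measurePreservingHomeo := ⟨bernoulliShift, bernoulliShift_mem⟩

/-! ### The conclusion -/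

/-- For all `n ≥ 1`, the groups `G ^ n` and `L₀(G)` have a cyclically dense conjugacy class, and each
of them is cyclically generated by a pair that generates a free group and whose first entry is
`(g, …, g)`, respectively the constant function with value `g`. -/
def CyclicallyDenseWithWitness (G : Type*) [TopologicalSpace G] [Group G] [IsTopologicalGroup G]
    [PolishSpace G] (g : G) : Prop :=
  (∀ n : ℕ, 1 ≤ n → HasCyclicallyDenseConjClass (Fin n → G)) ∧
  HasCyclicallyDenseConjClass (L0 G) ∧
  (∀ n : ℕ, 1 ≤ n → ∃ b : Fin n → G,
    CyclicallyGenerates (fun _ => g) b ∧ GeneratesFreeGroup (fun _ => g) b) ∧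
  ∃ b : L0 G, CyclicallyGenerates (L0.const g) b ∧ GeneratesFreeGroup (L0.const g) b

end

noncomputable section

open Filter Uniformity

/-! Everything reduces to two properties of `g` alone. The first, `ConjMixing`, is topological
mixing of conjugation by `g`. Mixing, unlike transitivity, passes to finite powers, and a Baire
category argument then yields a dense orbit (`ConjMixing.exists_cyclicallyGenerates`). The second,
`NoMixedIdentity`, says that no nontrivial word `w(g, ·)` is constantly `1`. If `w(g, b) = 1`, then
`w(g, ·)` is trivial on the whole orbit of `b` under conjugation by `g`; when that orbit is dense,
it is trivial everywhere. So every cyclically generating pair `(g, b)` is free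
(`CyclicallyGenerates.generatesFreeGroup`).

For `L₀(G)` the category argument is run in `C(2 ^ ℕ, G)`. Maps of finitely many digits form copies
of finite powers of `G`, and they are dense, so mixing passes to this group. It maps continuously,
homomorphically and with dense range into `L₀(G)`, which transfers cyclic generation; freeness is
read off by evaluating at a single point.

Mixing is obtained in two ways. For permutations, order automorphisms and measure-preserving
homeomorphisms, the elements whose conjugates by `g ^ l` and `g ^ (-l)` tend to `1` are dense
(`ConjMixing.of_dense_homoclinic`). For `H(2 ^ ℤ)`, a homeomorphism with prescribed behaviour on two
disjoint windows is built directly (`exists_homeomorph_comp_eq`).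

Mixed identities are excluded by ping-pong for words of bounded length
(`NoMixedIdentity.of_pingPong`). This is done by hand for the shift of `ℤ` and the unit shift of
`ℚ`. The other shifts of `ℚ` follow by rescaling, and the Bernoulli shifts because `S_∞` acts
faithfully on `2 ^ ℤ` by coordinate permutations. -/

/-! ### Mixing conjugations -/

/-- Conjugation by `g` is topologically mixing along the positive powers of `g`. -/
def ConjMixing {G : Type*} [Group G] [TopologicalSpace G] (g : G) : Prop :=
  ∀ U V : Set G, IsOpen U → U.Nonempty → IsOpen V → V.Nonempty →
    ∀ᶠ l : ℕ in atTop, ∃ h ∈ U, g ^ l * h * (g ^ l)⁻¹ ∈ V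

/-- No nontrivial word with constant `g` in one variable vanishes identically on `G`. -/
def NoMixedIdentity {G : Type*} [Group G] (g : G) : Prop :=
  ∀ w : FreeGroup (Fin 2), w ≠ 1 → ∃ x : G, FreeGroup.lift ![g, x] w ≠ 1

/-- Finitely many eventual conditions on `l` hold at once, so one exponent serves all coordinates.
Transitivity alone would give a separate exponent for each. -/
theorem ConjMixing.pi {G : Type*} [Group G] [TopologicalSpace G] {g : G} (hg : ConjMixing g)
    (ι : Type*) [Finite ι] : ConjMixing (fun _ : ι => g) := by
  rintro U V hU ⟨u, hu⟩ hV ⟨v, hv⟩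
  obtain ⟨A, hA, hAU⟩ := isOpen_pi_iff'.1 hU u hu
  obtain ⟨B, hB, hBV⟩ := isOpen_pi_iff'.1 hV v hv
  have h := eventually_all.2 fun i =>
    hg (A i) (B i) (hA i).1 ⟨_, (hA i).2⟩ (hB i).1 ⟨_, (hB i).2⟩
  filter_upwards [h] with l hl
  choose f hf hf' using hl
  exact ⟨f, hAU fun i _ => hf i, hBV fun i _ => hf' i⟩

/-- Birkhoff's transitivity argument: for each basic open `V`, the elements with some conjugate by
`g ^ l` in `V` form a dense open set. A point in the countable intersection has a dense orbit,
already along `l ≥ 0`. -/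
theorem ConjMixing.exists_cyclicallyGenerates {G : Type*} [Group G] [TopologicalSpace G]
    [ContinuousMul G] [BaireSpace G] [SecondCountableTopology G] {g : G}
    (hg : ConjMixing g) : ∃ b, CyclicallyGenerates g b := by
  obtain ⟨B, hBc, hBe, hB⟩ := TopologicalSpace.exists_countable_basis G
  have hopen : ∀ V ∈ B, IsOpen (⋃ l : ℕ, (fun h => g ^ l * h * (g ^ l)⁻¹) ⁻¹' V) := fun V hV =>
    isOpen_iUnion fun l => (hB.isOpen hV).preimage (by fun_prop)
  have hdense : ∀ V ∈ B, Dense (⋃ l : ℕ, (fun h => g ^ l * h * (g ^ l)⁻¹) ⁻¹' V) := by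
    intro V hV
    refine dense_iff_inter_open.2 fun U hU hUn => ?_
    have hVn : V.Nonempty := nonempty_iff_ne_empty.2 fun h => hBe (h ▸ hV)
    obtain ⟨l, h, hh, hl⟩ := (hg U V hU hUn (hB.isOpen hV) hVn).exists
    exact ⟨h, hh, mem_iUnion.2 ⟨l, hl⟩⟩
  obtain ⟨b, hb⟩ := (dense_biInter_of_isOpen hopen hBc hdense).nonempty
  refine ⟨b, hB.dense_iff.2 fun V hV _ => ?_⟩
  obtain ⟨l, hl⟩ := mem_iUnion.1 (mem_iInter₂.1 hb V hV)
  exact ⟨_, hl, l, by simp⟩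

/-! ### Freeness -/

theorem GeneratesFreeGroup.of_map {G H : Type*} [Group G] [Group H] (φ : G →* H) {g b : G}
    (h : GeneratesFreeGroup (φ g) (φ b)) : GeneratesFreeGroup g b := by
  have : (φ.comp (FreeGroup.lift ![g, b])) = FreeGroup.lift ![φ g, φ b] := by
    ext i; fin_cases i <;> simp
  unfold GeneratesFreeGroup at h ⊢
  rw [← this, MonoidHom.coe_comp] at h
  exact h.of_comp

theorem CyclicallyGenerates.map {G H : Type*} [Group G] [Group H] [TopologicalSpace G]
    [TopologicalSpace H] (φ : G →* H) (hφ : Continuous φ) (hd : DenseRange φ) {g b : G}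
    (h : CyclicallyGenerates g b) : CyclicallyGenerates (φ g) (φ b) := by
  refine (hd.dense_image hφ h).mono ?_
  rintro _ ⟨_, ⟨l, rfl⟩, rfl⟩
  exact ⟨l, by simp⟩

theorem FreeGroup.continuous_lift_pair {G : Type*} [Group G] [TopologicalSpace G]
    [IsTopologicalGroup G] (g : G) (w : FreeGroup (Fin 2)) :
    Continuous fun x : G => FreeGroup.lift ![g, x] w := by
  have hof : ∀ i : Fin 2, Continuous fun x : G => FreeGroup.lift ![g, x] (FreeGroup.of i) := by
    intro i
    fin_cases i
    · simpa using continuous_const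
    · simpa using continuous_id'
  induction w using FreeGroup.induction_on with
  | C1 => simpa using continuous_const
  | of i => exact hof i
  | inv_of i h => simp only [_root_.map_inv]; exact h.inv
  | mul a b ha hb => simp only [_root_.map_mul]; exact ha.mul hb

/-- Conjugation by `g ^ l` fixes `g`, so it acts on the second entry of the pair only. Hence the
solutions of `w(g, x) = 1` are invariant under this conjugation. -/
theorem FreeGroup.lift_pair_conj {G : Type*} [Group G] (g x : G) (l : ℤ)
    (w : FreeGroup (Fin 2)) :
    FreeGroup.lift ![g, g ^ l * x * g ^ (-l)] w = g ^ l * FreeGroup.lift ![g, x] w * g ^ (-l) := by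
  have : FreeGroup.lift ![g, g ^ l * x * g ^ (-l)] =
      ((MulAut.conj (g ^ l)).toMonoidHom.comp (FreeGroup.lift ![g, x])) := by
    ext i
    fin_cases i
    · simp [-map_zpow, MulAut.conj_apply, (Commute.refl g).zpow_left l |>.eq]
    · simp [-map_zpow, MulAut.conj_apply]
  rw [this]
  simp [-map_zpow, MulAut.conj_apply]

/-- The solution set of `w(g, x) = 1` is closed and invariant under conjugation by `g`. If it
contains `b`, it contains the closure of a dense orbit, and `w` would be a mixed identity. -/
theorem CyclicallyGenerates.generatesFreeGroup {G : Type*} [Group G] [TopologicalSpace G]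
    [IsTopologicalGroup G] [T2Space G] {g b : G} (hb : CyclicallyGenerates g b)
    (hg : NoMixedIdentity g) : GeneratesFreeGroup g b := by
  refine (injective_iff_map_eq_one _).2 fun w hw => ?_
  by_contra hne
  obtain ⟨x, hx⟩ := hg w hne
  refine hx ?_
  have hcl : IsClosed {x : G | FreeGroup.lift ![g, x] w = 1} :=
    isClosed_eq (FreeGroup.continuous_lift_pair g w) continuous_const
  refine closure_minimal ?_ hcl (hb x)
  rintro _ ⟨l, rfl⟩
  simp only [mem_ofPred_eq]
  rw [FreeGroup.lift_pair_conj, hw]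
  simp

/-! ### Cylinders -/

theorem exists_finset_of_mem_uniformity {ι : Type*} {V : Set ((ι → Bool) × (ι → Bool))}
    (hV : V ∈ 𝓤 (ι → Bool)) :
    ∃ W : Finset ι, ∀ x y : ι → Bool, (∀ i ∈ W, x i = y i) → (x, y) ∈ V := by
  rw [Pi.uniformity] at hV
  simp only [DiscreteUniformity.eq_principal_setRelId, comap_principal] at hV
  obtain ⟨W, hW, h⟩ := (hasBasis_iInf_principal_finite _).mem_iff.1 hV
  refine ⟨hW.toFinset, fun x y hxy => h ?_⟩
  simp only [mem_iInter, mem_preimage]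
  exact fun i hi => hxy i (hW.mem_toFinset.2 hi)

theorem cylinder_mem_uniformity {ι : Type*} (W : Finset ι) :
    {p : (ι → Bool) × (ι → Bool) | ∀ i ∈ W, p.1 i = p.2 i} ∈ 𝓤 (ι → Bool) := by
  have : {p : (ι → Bool) × (ι → Bool) | ∀ i ∈ W, p.1 i = p.2 i} =
      ⋂ i ∈ W, {p | p.1 i = p.2 i} := by ext; simp
  rw [this]
  refine (biInter_finset_mem W).2 fun i _ => ?_
  exact (Pi.uniformContinuous_proj (fun _ : ι => Bool) i)
    (DiscreteUniformity.relId_mem_uniformity (X := Bool))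

/-- The continuous retraction of `2 ^ ℕ` onto sequences that vanish from `n` on. -/
def cantorTrunc (n : ℕ) : C(ℕ → Bool, ℕ → Bool) where
  toFun x i := if i < n then x i else false
  continuous_toFun := continuous_pi fun i => by
    by_cases h : i < n
    · simpa [h] using continuous_apply i
    · simpa [h] using continuous_const

theorem tendsto_cantorTrunc :
    Tendsto cantorTrunc atTop (𝓝 (ContinuousMap.id (ℕ → Bool))) := by
  refine ContinuousMap.tendsto_iff_tendstoUniformly.2 fun V hV => ?_
  obtain ⟨W, hW⟩ := exists_finset_of_mem_uniformity hV
  have : ∀ᶠ n : ℕ in atTop, ∀ i ∈ W, i < n :=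
    (eventually_all_finset W).2 fun i _ => eventually_gt_atTop i
  filter_upwards [this] with n hn x
  exact hW _ _ fun i hi => by simp [cantorTrunc, hn i hi]

/-- Functions of the first `n` coordinates, as continuous functions on `2 ^ ℕ`. -/
def cantorPull (G : Type*) [TopologicalSpace G] (n : ℕ) (a : (Fin n → Bool) → G) :
    C(ℕ → Bool, G) where
  toFun x := a fun i => x i
  continuous_toFun := continuous_of_discreteTopology.comp
    (continuous_pi fun i : Fin n => continuous_apply (i : ℕ))

theorem continuous_cantorPull (G : Type*) [TopologicalSpace G] (n : ℕ) :
    Continuous (cantorPull G n) := by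
  refine ContinuousMap.continuous_of_continuous_uncurry _ ?_
  have : Continuous fun p : (Fin n → Bool) × ((Fin n → Bool) → G) => p.2 p.1 :=
    continuous_prod_of_discrete_left.2 fun i => continuous_apply i
  have h2 : Continuous fun p : ((Fin n → Bool) → G) × (ℕ → Bool) =>
      ((fun i : Fin n => p.2 i), p.1) :=
    (continuous_pi fun i : Fin n => (continuous_apply (i : ℕ)).comp continuous_snd).prodMk
      continuous_fst
  exact this.comp h2

theorem exists_cantorPull_eq {G : Type*} [TopologicalSpace G] (n : ℕ) (F : C(ℕ → Bool, G)) :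
    ∃ a, cantorPull G n a = F.comp (cantorTrunc n) := by
  refine ⟨fun u => F fun i => if h : i < n then u ⟨i, h⟩ else false, ?_⟩
  ext x
  simp [cantorPull, cantorTrunc]

/-- Truncation makes the maps depending on finitely many digits dense. Those depending on the first
`n` digits are a copy of the power of `G` indexed by `Fin n → Bool`, where `ConjMixing.pi` applies.
-/
theorem ConjMixing.continuousMap {G : Type*} [Group G] [TopologicalSpace G]
    [IsTopologicalGroup G] {g : G} (hg : ConjMixing g) :
    ConjMixing (ContinuousMap.const (ℕ → Bool) g) := by
  rintro U V hU ⟨u, hu⟩ hV ⟨v, hv⟩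
  have key : ∀ F : C(ℕ → Bool, G), Tendsto (fun n => F.comp (cantorTrunc n)) atTop (𝓝 F) := by
    intro F
    have h := ((ContinuousMap.continuous_postcomp F).tendsto _).comp tendsto_cantorTrunc
    rwa [ContinuousMap.comp_id] at h
  obtain ⟨n, hnu, hnv⟩ := (((key u).eventually (hU.mem_nhds hu)).and
    ((key v).eventually (hV.mem_nhds hv))).exists
  obtain ⟨a, ha⟩ := exists_cantorPull_eq n u
  obtain ⟨c, hc⟩ := exists_cantorPull_eq n v
  filter_upwards [hg.pi (Fin n → Bool) _ _ (hU.preimage (continuous_cantorPull G n))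
    ⟨a, by rwa [mem_preimage, ha]⟩ (hV.preimage (continuous_cantorPull G n))
    ⟨c, by rwa [mem_preimage, hc]⟩] with l ⟨h, hh, hl⟩
  exact ⟨_, hh, hl⟩

/-! ### Continuous functions on the Cantor space inside `L₀(G)` -/

/-- A measurable map `[0,1] → 2 ^ ℕ` through which the Borel sets are pulled back. -/
def cantorCode : unitInterval → ℕ → Bool := MeasurableSpace.mapNatBool unitInterval

theorem measurable_cantorCode : Measurable cantorCode :=
  MeasurableSpace.measurable_mapNatBool unitInterval

/-- The preimages of clopen sets form an algebra that generates the Borel sets, so they approximate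
every Borel set in measure. -/
theorem measureDense_cantorCode :
    (volume : Measure unitInterval).MeasureDense {s | ∃ C, IsClopen C ∧ cantorCode ⁻¹' C = s} := by
  refine Measure.MeasureDense.of_generateFrom_isSetAlgebra_finite _
    ⟨⟨∅, isClopen_empty, rfl⟩, ?_, ?_⟩ (le_antisymm ?_ ?_)
  · rintro _ ⟨C, hC, rfl⟩
    exact ⟨Cᶜ, hC.compl, rfl⟩
  · rintro _ _ ⟨C, hC, rfl⟩ ⟨D, hD, rfl⟩
    exact ⟨C ∪ D, hC.union hD, rfl⟩
  · refine (MeasurableSpace.generateFrom_natGeneratingSequence unitInterval).ge.trans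
      (MeasurableSpace.generateFrom_mono ?_)
    rintro _ ⟨n, rfl⟩
    refine ⟨{x | x n = true}, (isClopen_discrete {true}).preimage (continuous_apply n), ?_⟩
    ext x
    simp [cantorCode, MeasurableSpace.mapNatBool]
  · refine MeasurableSpace.generateFrom_le ?_
    rintro _ ⟨C, hC, rfl⟩
    exact measurable_cantorCode hC.isOpen.measurableSet

theorem ContinuousMap.aestronglyMeasurable_comp_cantorCode {G : Type*} [TopologicalSpace G]
    (F : C(ℕ → Bool, G)) : AEStronglyMeasurable (F ∘ cantorCode) (volume : Measure unitInterval) :=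
  (F.continuous.comp_stronglyMeasurable
    measurable_cantorCode.stronglyMeasurable).aestronglyMeasurable

/-- The homomorphism `C(2 ^ ℕ, G) → L₀(G)` of composition with `cantorCode`. -/
def cantorToL0 (G : Type*) [TopologicalSpace G] [Group G] [IsTopologicalGroup G] :
    C(ℕ → Bool, G) →* L0 G where
  toFun F := (AEEqFun.mk _ F.aestronglyMeasurable_comp_cantorCode : unitInterval →ₘ[volume] G)
  map_one' := rfl
  map_mul' F F' := (AEEqFun.mk_mul_mk _ _ F.aestronglyMeasurable_comp_cantorCode
    F'.aestronglyMeasurable_comp_cantorCode).symm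

theorem cantorToL0_ae {G : Type*} [TopologicalSpace G] [Group G] [IsTopologicalGroup G]
    (F : C(ℕ → Bool, G)) : ∀ᵐ x, cantorToL0 G F x = F (cantorCode x) :=
  AEEqFun.coeFn_mk _ F.aestronglyMeasurable_comp_cantorCode

theorem cantorToL0_const {G : Type*} [TopologicalSpace G] [Group G] [IsTopologicalGroup G]
    (g : G) : cantorToL0 G (ContinuousMap.const _ g) = L0.const g := rfl

theorem L0.mem_nhd_of_ae {Y : Type*} [TopologicalSpace Y] [PolishSpace Y] {h f : L0 Y}
    {δ ε : ℝ} (hε : 0 < ε)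
    (H : letI := TopologicalSpace.upgradeIsCompletelyMetrizable Y
      ∀ᵐ x, dist (f x) (h x) < δ) : f ∈ L0.nhd h δ ε := by
  let _ := TopologicalSpace.upgradeIsCompletelyMetrizable Y
  change 1 - ε < (volume : Measure unitInterval).real {x | dist (f x) (h x) < δ}
  have : (volume : Measure unitInterval).real {x | dist (f x) (h x) < δ} = 1 := by
    rw [measureReal_def, measure_congr (eventuallyEq_univ.2 H)]
    simp
  linarith

theorem continuous_cantorToL0 (G : Type*) [TopologicalSpace G] [Group G] [IsTopologicalGroup G]
    [PolishSpace G] : Continuous (cantorToL0 G) := by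
  refine continuous_iff_continuousAt.2 fun F => (L0.hasBasis_nhds _).tendsto_right_iff.2 ?_
  rintro ⟨δ, ε⟩ ⟨hδ, hε⟩
  let _ := TopologicalSpace.upgradeIsCompletelyMetrizable G
  have hF : ∀ᶠ F' in 𝓝 F, dist F' F < δ := Metric.ball_mem_nhds F hδ
  filter_upwards [hF] with F' hF'
  refine L0.mem_nhd_of_ae hε ?_
  filter_upwards [cantorToL0_ae F, cantorToL0_ae F'] with x hx hx'
  rw [hx, hx']
  exact (ContinuousMap.dist_apply_le_dist _).trans_lt hF'

/-- A simple function agrees, off a set of small measure, with the composition of a continuous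
function on `2 ^ ℕ` with `cantorCode`. -/
theorem exists_continuousMap_eq_simpleFunc {G : Type*} [TopologicalSpace G]
    (s : SimpleFunc unitInterval G) {ε : ENNReal} (hε : ε ≠ 0) :
    ∃ F : C(ℕ → Bool, G), (volume : Measure unitInterval) {x | s x ≠ F (cantorCode x)} < ε := by
  classical
  obtain ⟨ε', hε', hsum⟩ := ENNReal.exists_pos_sum_of_countable hε s.range
  have := fun y : s.range => measureDense_cantorCode.approx (s ⁻¹' {y.1})
    (s.measurableSet_fiber _) (measure_ne_top _ _) (ε' y) (by exact_mod_cast hε' y)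
  choose t ht htε using this
  choose C hC hCt using ht
  -- A default value for codes lying in no `C y`. The sets `C y` need not cover, nor be disjoint;
  -- both failures occur only over the small symmetric differences.
  have y0 : G := s 0
  let F : (ℕ → Bool) → G := fun c => if h : ∃ y, c ∈ C y then (h.choose : G) else y0
  have hF : IsLocallyConstant F := by
    let q : (ℕ → Bool) → s.range → Prop := fun c y => c ∈ C y
    have hq : IsLocallyConstant q := by
      refine (IsLocallyConstant.iff_eventually_eq _).2 fun c => ?_
      have : ∀ y, ∀ᶠ c' in 𝓝 c, (c' ∈ C y) = (c ∈ C y) := by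
        intro y
        by_cases h : c ∈ C y
        · filter_upwards [(hC y).isOpen.mem_nhds h] with c' hc'
          simp [h, hc']
        · filter_upwards [(hC y).compl.isOpen.mem_nhds h] with c' hc'
          simpa [h] using hc'
      filter_upwards [eventually_all.2 this] with c' hc'
      funext y
      exact hc' y
    have : F = (fun p : s.range → Prop => if h : ∃ y, p y then (h.choose : G) else y0) ∘ q := rfl
    rw [this]
    exact hq.comp _
  refine ⟨⟨F, hF.continuous⟩, lt_of_le_of_lt ?_ hsum⟩
  have hsub : {x | s x ≠ F (cantorCode x)} ⊆ ⋃ y : s.range, symmDiff (s ⁻¹' {y.1}) (t y) := by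
    intro x hx
    by_contra hbad
    simp only [mem_iUnion, not_exists] at hbad
    refine hx ?_
    -- Off the symmetric differences, the code of `x` lies in exactly one `C y`, namely that of `y =
    -- s x`, so the choice in `F` is forced.
    have hmem : ∀ y : s.range, cantorCode x ∈ C y ↔ s x = y := by
      intro y
      have := hbad y
      rw [← hCt y, mem_symmDiff] at this
      simp only [mem_preimage, mem_singleton_iff] at this
      tauto
    have hex : ∃ y, cantorCode x ∈ C y := ⟨⟨s x, s.mem_range_self x⟩, (hmem _).2 rfl⟩
    have : F (cantorCode x) = hex.choose := dif_pos hex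
    rw [this]
    exact (hmem _).1 hex.choose_spec
  calc (volume : Measure unitInterval) {x | s x ≠ F (cantorCode x)}
      ≤ volume (⋃ y : s.range, symmDiff (s ⁻¹' {y.1}) (t y)) := measure_mono hsub
    _ ≤ ∑' y : s.range, volume (symmDiff (s ⁻¹' {y.1}) (t y)) := measure_iUnion_le _
    _ ≤ ∑' y : s.range, (ε' y : ENNReal) := ENNReal.tsum_le_tsum fun y => by
        simpa using (htε y).le

/-- Half of `ε` pays for approximating `f` by a simple function in measure, the other half for
replacing the simple function by a continuous function of the code. -/
theorem denseRange_cantorToL0 (G : Type*) [TopologicalSpace G] [Group G] [IsTopologicalGroup G]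
    [PolishSpace G] : DenseRange (cantorToL0 G) := by
  intro f
  refine (mem_closure_iff_nhds_basis (L0.hasBasis_nhds f)).2 ?_
  rintro ⟨δ, ε⟩ ⟨hδ, hε⟩
  let _ := TopologicalSpace.upgradeIsCompletelyMetrizable G
  have hf : StronglyMeasurable (f : unitInterval → G) :=
    AEEqFun.stronglyMeasurable (f : unitInterval →ₘ[volume] G)
  have hm := tendstoInMeasure_of_tendsto_ae (μ := (volume : Measure unitInterval))
    (fun n => (hf.approx n).stronglyMeasurable.aestronglyMeasurable)
    (ae_of_all _ hf.tendsto_approx)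
  have hε2 : ENNReal.ofReal (ε / 2) ≠ 0 := by simpa using hε
  obtain ⟨n, hn⟩ := ((hm (ENNReal.ofReal δ) (by simpa using hδ)).eventually
    (gt_mem_nhds (pos_iff_ne_zero.2 hε2))).exists
  obtain ⟨F, hF⟩ := exists_continuousMap_eq_simpleFunc (hf.approx n) hε2
  refine ⟨_, ⟨F, rfl⟩, ?_⟩
  change 1 - ε < (volume : Measure unitInterval).real {x | dist (cantorToL0 G F x) (f x) < δ}
  have hle : (volume : Measure unitInterval) {x | dist (cantorToL0 G F x) (f x) < δ}ᶜ
      < ENNReal.ofReal ε := by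
    have hsub : ({x | dist (cantorToL0 G F x) (f x) < δ}ᶜ : Set unitInterval) ≤ᵐ[volume]
        ({x | ENNReal.ofReal δ ≤ edist (hf.approx n x) (f x)} ∪
          {x | hf.approx n x ≠ F (cantorCode x)} : Set unitInterval) := by
      filter_upwards [cantorToL0_ae F] with x hx hx'
      by_cases h : hf.approx n x = F (cantorCode x)
      · left
        change ENNReal.ofReal δ ≤ edist (hf.approx n x) (f x)
        rw [h, ← hx, edist_dist]
        exact ENNReal.ofReal_le_ofReal (not_lt.1 hx')
      · exact Or.inr h
    refine ((measure_mono_ae hsub).trans (measure_union_le _ _)).trans_lt ?_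
    refine (ENNReal.add_lt_add hn hF).trans_eq ?_
    rw [← ENNReal.ofReal_add (by positivity) (by positivity)]
    simp
  have hmeas : MeasurableSet {x | dist (cantorToL0 G F x) (f x) < δ} := by
    have : Measurable fun x => dist (cantorToL0 G F x) (f x) :=
      ((AEEqFun.stronglyMeasurable (cantorToL0 G F : unitInterval →ₘ[volume] G)).dist hf).measurable
    exact measurableSet_lt this measurable_const
  have h1 := probReal_compl_eq_one_sub (μ := (volume : Measure unitInterval)) hmeas
  have h2 : (volume : Measure unitInterval).real {x | dist (cantorToL0 G F x) (f x) < δ}ᶜ < ε :=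
    (ENNReal.toReal_lt_of_lt_ofReal hle)
  linarith

/-! ### The general criterion -/

theorem ConjMixing.cyclicallyDenseWithWitness {G : Type*} [TopologicalSpace G] [Group G]
    [IsTopologicalGroup G] [PolishSpace G] {g : G} (hg : ConjMixing g) (hw : NoMixedIdentity g) :
    CyclicallyDenseWithWitness G g := by
  have hpow : ∀ n : ℕ, 1 ≤ n → ∃ b : Fin n → G,
      CyclicallyGenerates (fun _ => g) b ∧ GeneratesFreeGroup (fun _ => g) b := by
    intro n hn
    obtain ⟨b, hb⟩ := (hg.pi (Fin n)).exists_cyclicallyGenerates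
    -- One coordinate suffices for freeness: the projected pair still cyclically generates `G`.
    refine ⟨b, hb, GeneratesFreeGroup.of_map (Pi.evalMonoidHom (fun _ : Fin n => G) ⟨0, hn⟩) ?_⟩
    refine CyclicallyGenerates.generatesFreeGroup (hb.map _ (continuous_apply _) ?_) hw
    exact Function.Surjective.denseRange fun y => ⟨fun _ => y, rfl⟩
  have hL0 : ∃ b : L0 G, CyclicallyGenerates (L0.const g) b ∧
      GeneratesFreeGroup (L0.const g) b := by
    have : BaireSpace C(ℕ → Bool, G) := by
      let _ := TopologicalSpace.upgradeIsCompletelyMetrizable G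
      infer_instance
    obtain ⟨b, hb⟩ := hg.continuousMap.exists_cyclicallyGenerates
    refine ⟨cantorToL0 G b, ?_, ?_⟩
    · rw [← cantorToL0_const]
      exact hb.map _ (continuous_cantorToL0 G) (denseRange_cantorToL0 G)
    · have hlift : FreeGroup.lift ![L0.const g, cantorToL0 G b] =
          (cantorToL0 G).comp (FreeGroup.lift ![ContinuousMap.const _ g, b]) := by
        ext i
        fin_cases i <;> simp [← cantorToL0_const]
      refine (injective_iff_map_eq_one _).2 fun w hw1 => ?_
      rw [hlift, MonoidHom.comp_apply] at hw1
      -- Choose one point, depending on `w`, where the representatives take their expected values.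
      -- Evaluation at its code sends `b` to an element that cyclically generates `G` with `g`,
      -- hence forms a free pair, so `w` must be trivial.
      obtain ⟨x, hx, hx1⟩ := ((cantorToL0_ae (FreeGroup.lift ![ContinuousMap.const _ g, b] w)).and
        (AEEqFun.coeFn_one (α := unitInterval) (β := G) (μ := volume))).exists
      rw [hw1] at hx
      let ev : C(ℕ → Bool, G) →* G :=
        { toFun := fun F => F (cantorCode x), map_one' := rfl, map_mul' := fun _ _ => rfl }
      have hev : CyclicallyGenerates g (ev b) := by
        refine hb.map ev (continuous_eval_const (cantorCode x)) ?_
        exact Function.Surjective.denseRange fun y => ⟨ContinuousMap.const _ y, rfl⟩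
      have hlift2 : FreeGroup.lift ![g, ev b] =
          ev.comp (FreeGroup.lift ![ContinuousMap.const _ g, b]) := by
        ext i
        fin_cases i <;> simp <;> rfl
      refine (injective_iff_map_eq_one _).1 (hev.generatesFreeGroup hw) w ?_
      rw [hlift2]
      exact hx.symm.trans hx1
  refine ⟨fun n hn => ?_, ?_, hpow, hL0⟩
  · obtain ⟨b, hb, -⟩ := hpow n hn
    exact ⟨_, b, hb⟩
  · obtain ⟨b, hb, -⟩ := hL0
    exact ⟨_, b, hb⟩

/-! ### Mixing from homoclinic elements -/

/-- With `σ ∈ U` and `τ ∈ V` homoclinic, `σ * (g ^ l)⁻¹ * τ * g ^ l` is close to `σ`, and its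
conjugate by `g ^ l`, which is `g ^ l * σ * (g ^ l)⁻¹ * τ`, is close to `τ`. -/
theorem ConjMixing.of_dense_homoclinic {G : Type*} [Group G] [TopologicalSpace G]
    [IsTopologicalGroup G] {g : G}
    (hd : Dense {τ : G | Tendsto (fun l : ℕ => g ^ l * τ * (g ^ l)⁻¹) atTop (𝓝 1) ∧
      Tendsto (fun l : ℕ => (g ^ l)⁻¹ * τ * g ^ l) atTop (𝓝 1)}) : ConjMixing g := by
  intro U V hU hUn hV hVn
  obtain ⟨σ, hσU, hσ, -⟩ := hd.inter_open_nonempty U hU hUn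
  obtain ⟨τ, hτV, -, hτ⟩ := hd.inter_open_nonempty V hV hVn
  have h1 : Tendsto (fun l : ℕ => σ * ((g ^ l)⁻¹ * τ * g ^ l)) atTop (𝓝 σ) := by
    simpa using hτ.const_mul σ
  have h2 : Tendsto (fun l : ℕ => (g ^ l * σ * (g ^ l)⁻¹) * τ) atTop (𝓝 τ) := by
    simpa using hσ.mul_const τ
  filter_upwards [h1.eventually (hU.mem_nhds hσU), h2.eventually (hV.mem_nhds hτV)] with l hl hl'
  refine ⟨_, hl, ?_⟩
  have : g ^ l * (σ * ((g ^ l)⁻¹ * τ * g ^ l)) * (g ^ l)⁻¹ = g ^ l * σ * (g ^ l)⁻¹ * τ := by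
    group
  rw [this]
  exact hl'

/-! ### Ping-pong for words of bounded length -/

/-- The position of the image of a base point `p` under a word, in the ping-pong argument. -/
def PingPongState {X : Type*} (g : Equiv.Perm X) (P : Set X) (T : Bool → Set X) (p : X) :
    List (Fin 2 × Bool) → X → Prop
  | [], y => y = p
  | (i, b) :: L, y => if i = 0 then
      ∃ k : ℕ, 0 < k ∧ k ≤ L.length + 1 ∧ ∃ z ∈ P, y = ((cond b g g⁻¹) ^ k) z
    else y ∈ T b

/-- Letters act from the right end of the word. After a run of at most `N - 1` letters `g ^ ±1` the
point has left `P`, hence both sets `T b`, and the next `x ^ ±1` sends it into `T true` or `T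
false`. Since `T b ⊆ P`, the next run of `g` starts in `P` again. Only powers below `N` occur, so
`P` may depend on the length of the word. -/
theorem pingPongState_prod {X : Type*} {g x : Equiv.Perm X} {N : ℕ} {P : Set X}
    {T : Bool → Set X} {p : X} (hT : ∀ b, T b ⊆ P) (hdisj : Disjoint (T true) (T false))
    (hp : p ∈ P) (hpT : ∀ b, p ∉ T b) (hx : ∀ b, ∀ y ∉ T (!b), (cond b x x⁻¹) y ∈ T b)
    (hg : ∀ k : ℕ, 0 < k → k < N → ∀ y ∈ P, (g ^ k) y ∉ P) :
    ∀ L : List (Fin 2 × Bool), FreeGroup.IsReduced L → L.length < N →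
      PingPongState g P T p L
        ((L.map fun a => cond a.2 (![g, x] a.1) (![g, x] a.1)⁻¹).prod p) := by
  have hg' : ∀ b, ∀ k : ℕ, 0 < k → k < N → ∀ y ∈ P, ((cond b g g⁻¹) ^ k) y ∉ P := by
    rintro (_ | _) k hk hkN y hy
    · intro hz
      refine hg k hk hkN _ hz ?_
      simpa using hy
    · exact hg k hk hkN y hy
  have hd : ∀ b y, y ∈ T b → y ∉ T (!b) := by
    rintro (_ | _) y hy hy'
    · exact disjoint_left.1 hdisj hy' hy
    · exact disjoint_left.1 hdisj hy hy'
  intro L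
  induction L with
  | nil => intro _ _; simp [PingPongState]
  | cons c L ih =>
    intro hred hlen
    have hredL : FreeGroup.IsReduced L := List.IsChain.tail hred
    rw [List.length_cons] at hlen
    have IH := ih hredL (by omega)
    rw [List.map_cons, List.prod_cons, Equiv.Perm.mul_apply]
    generalize ((L.map fun a => cond a.2 (![g, x] a.1) (![g, x] a.1)⁻¹).prod p) = y at IH
    obtain ⟨i, b⟩ := c
    fin_cases i
    · simp only [PingPongState, Fin.zero_eta, if_true, Matrix.cons_val_zero]
      rcases L with _ | ⟨⟨j, b'⟩, L⟩
      · exact ⟨1, one_pos, le_add_self, y, (IH : y = p) ▸ hp, by simp⟩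
      · fin_cases j
        · simp only [PingPongState, Fin.zero_eta, if_true] at IH
          -- Reducedness: adjacent letters of the same generator have the same sign, so the run of
          -- `g` gets longer by one.
          obtain rfl : b = b' := (FreeGroup.isReduced_cons_cons.1 hred).1 rfl
          obtain ⟨k, hk, hkL, z, hz, rfl⟩ := IH
          exact ⟨k + 1, by omega, by simpa using hkL, z, hz, by rw [pow_succ']; rfl⟩
        · exact ⟨1, one_pos, le_add_self, y, hT b' IH, by simp⟩
    · change (cond b x x⁻¹) y ∈ T b
      apply hx
      rcases L with _ | ⟨⟨j, b'⟩, L⟩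
      · exact (IH : y = p) ▸ hpT _
      · fin_cases j
        · simp only [PingPongState, Fin.zero_eta, if_true] at IH
          obtain ⟨k, hk, hkL, z, hz, rfl⟩ := IH
          rw [List.length_cons] at hlen
          exact fun h => hg' b' k hk (by omega) z hz (hT _ h)
        · obtain rfl : b = b' := (FreeGroup.isReduced_cons_cons.1 hred).1 rfl
          exact hd b y IH

theorem NoMixedIdentity.of_pingPong {G X : Type*} [Group G] (φ : G →* Equiv.Perm X) {g : G}
    (H : ∀ N : ℕ, 0 < N → ∃ (x : G) (P : Set X) (T : Bool → Set X) (p : X), (∀ b, T b ⊆ P) ∧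
      Disjoint (T true) (T false) ∧ p ∈ P ∧ (∀ b, p ∉ T b) ∧
      (∀ y ∉ T false, φ x y ∈ T true) ∧ (∀ y ∉ T true, (φ x)⁻¹ y ∈ T false) ∧
      ∀ k : ℕ, 0 < k → k < N → ∀ y ∈ P, (φ g ^ k) y ∉ P) : NoMixedIdentity g := by
  intro w hw
  obtain ⟨x, P, T, p, hT, hdisj, hp, hpT, hx, hx', hg⟩ := H (w.toWord.length + 1) (by omega)
  refine ⟨x, fun h => ?_⟩
  have hlift : FreeGroup.lift ![φ g, φ x] = φ.comp (FreeGroup.lift ![g, x]) := by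
    ext i : 1; fin_cases i <;> simp
  have hs := pingPongState_prod hT hdisj hp hpT
    (fun b => match b with | true => hx | false => hx') hg w.toWord
    FreeGroup.isReduced_toWord (by omega)
  rw [← FreeGroup.lift_mk, FreeGroup.mk_toWord, hlift, MonoidHom.comp_apply, h, map_one,
    Equiv.Perm.one_apply] at hs
  have hlen : w.toWord.length < w.toWord.length + 1 := by omega
  generalize w.toWord.length + 1 = N at hg hlen
  have hne : w.toWord ≠ [] := fun h => hw (FreeGroup.toWord_eq_nil_iff.1 h)
  rcases hL : w.toWord with _ | ⟨⟨i, b⟩, L⟩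
  · exact hne hL
  · rw [hL] at hs hlen
    rw [List.length_cons] at hlen
    fin_cases i
    · simp only [PingPongState, Fin.zero_eta, if_true] at hs
      obtain ⟨k, hk, hkL, z, hz, hpz⟩ := hs
      -- The word fixes `p`, so `p` is a short power of `g` applied to `z`. For a negative power,
      -- read this as `g ^ k` carrying `p` to `z`; both lie in `P`, which is excluded.
      rcases b with _ | _
      · refine hg k hk (by omega) p hp ?_
        rw [hpz]
        simpa using hz
      · refine hg k hk (by omega) z hz ?_
        rw [cond_true] at hpz
        exact hpz ▸ hp
    · exact hpT b hs

/-- A mixed identity of `H` with constant `φ g` would restrict to one of `G` with constant `g`. -/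
theorem NoMixedIdentity.map {G H : Type*} [Group G] [Group H] {g : G} (hg : NoMixedIdentity g)
    (φ : G →* H) (hφ : Function.Injective φ) : NoMixedIdentity (φ g) := by
  intro w hw
  obtain ⟨x, hx⟩ := hg w hw
  refine ⟨φ x, fun h => hx (hφ ?_)⟩
  have hlift : FreeGroup.lift ![φ g, φ x] = φ.comp (FreeGroup.lift ![g, x]) := by
    ext i : 1; fin_cases i <;> simp
  rw [map_one, ← h, hlift, MonoidHom.comp_apply]

/-! ### Topologies of pointwise convergence -/

theorem Equiv.Perm.tendsto_iff_eventually_eq {M α : Type*} {F : Filter α} {f : α → Equiv.Perm M}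
    {σ : Equiv.Perm M} : Tendsto f F (𝓝 σ) ↔ ∀ x, ∀ᶠ a in F, f a x = σ x := by
  let _ : TopologicalSpace M := ⊥
  have _ : DiscreteTopology M := ⟨rfl⟩
  have hi : IsInducing fun (σ : Equiv.Perm M) (x : M) => σ x := ⟨rfl⟩
  rw [hi.tendsto_nhds_iff, tendsto_pi_nhds]
  simp [nhds_discrete]

theorem Equiv.Perm.exists_finset_of_mem_nhds {M : Type*} {σ : Equiv.Perm M}
    {U : Set (Equiv.Perm M)} (hU : U ∈ 𝓝 σ) :
    ∃ W : Finset M, ∀ τ : Equiv.Perm M, (∀ x ∈ W, τ x = σ x) → τ ∈ U := by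
  let _ : TopologicalSpace M := ⊥
  have _ : DiscreteTopology M := ⟨rfl⟩
  have hi : IsInducing fun (σ : Equiv.Perm M) (x : M) => σ x := ⟨rfl⟩
  rw [hi.nhds_eq_comap, nhds_pi] at hU
  simp only [nhds_discrete] at hU
  obtain ⟨V, hV, hVU⟩ := mem_comap.1 hU
  obtain ⟨I, hI, t, ht, hV'⟩ := Filter.mem_pi.1 hV
  refine ⟨hI.toFinset, fun τ hτ => hVU (hV' fun i hi => ?_)⟩
  change τ i ∈ t i
  rw [hτ i (hI.mem_toFinset.2 hi)]
  exact ht i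

/-! ### The group `S_∞` -/

theorem intShift_pow_apply (l : ℕ) (x : ℤ) : (intShift ^ l) x = x + l := by
  induction l generalizing x with
  | zero => simp
  | succ l ih => rw [pow_succ, Equiv.Perm.mul_apply, ih]; simp [intShift]; ring

theorem intShift_pow_inv_apply (l : ℕ) (x : ℤ) : (intShift ^ l)⁻¹ x = x - l := by
  rw [Equiv.Perm.inv_eq_iff_eq, intShift_pow_apply]; ring

theorem Equiv.Perm.exists_finite_support_eqOn {M : Type*} (σ : Equiv.Perm M)
    (W : Finset M) : ∃ τ : Equiv.Perm M, {x | τ x ≠ x}.Finite ∧ ∀ x ∈ W, τ x = σ x := by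
  classical
  induction W using Finset.induction_on with
  | empty => exact ⟨1, by simp, by simp⟩
  | insert a W ha ih =>
    obtain ⟨τ, hτ, h⟩ := ih
    -- The transposition corrects the value at `a`. It leaves the values on `W` alone, since there
    -- `τ x = σ x` differs from both `τ a` and `σ a` by injectivity.
    refine ⟨Equiv.swap (τ a) (σ a) * τ, ?_, ?_⟩
    · refine (hτ.union (toFinite {τ a, σ a})).subset fun x hx => ?_
      by_contra hx'
      simp only [mem_union, mem_insert_iff, mem_singleton_iff, not_or, mem_ofPred_eq, not_not]
        at hx'
      refine hx ?_
      rw [Equiv.Perm.mul_apply, hx'.1, Equiv.swap_apply_of_ne_of_ne hx'.2.1 hx'.2.2]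
    · intro x hx
      rcases Finset.mem_insert.1 hx with rfl | hx
      · simp
      · have hne : x ≠ a := fun h => ha (h ▸ hx)
        rw [Equiv.Perm.mul_apply, Equiv.swap_apply_of_ne_of_ne (fun e => hne (τ.injective e))
          (fun e => hne (σ.injective ((h x hx).symm.trans e))), h x hx]

theorem conjMixing_intShift : ConjMixing intShift := by
  refine ConjMixing.of_dense_homoclinic fun σ => mem_closure_iff_nhds.2 fun U hU => ?_
  obtain ⟨W, hW⟩ := Equiv.Perm.exists_finset_of_mem_nhds hU
  obtain ⟨τ, hτ, h⟩ := σ.exists_finite_support_eqOn W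
  refine ⟨τ, hW τ h, ?_, ?_⟩
  · refine Equiv.Perm.tendsto_iff_eventually_eq.2 fun x => ?_
    have hinj : Function.Injective fun l : ℕ => x - (l : ℤ) := fun a b hab => by
      simpa using hab
    have := hinj.tendsto_cofinite.eventually hτ.compl_mem_cofinite
    rw [Nat.cofinite_eq_atTop] at this
    filter_upwards [this] with l hl
    have hl : τ (x - l) = x - l := not_not.1 hl
    rw [Equiv.Perm.mul_apply, Equiv.Perm.mul_apply, intShift_pow_inv_apply, hl,
      intShift_pow_apply]
    simp
  · refine Equiv.Perm.tendsto_iff_eventually_eq.2 fun x => ?_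
    have hinj : Function.Injective fun l : ℕ => x + (l : ℤ) := fun a b hab => by
      simpa using hab
    have := hinj.tendsto_cofinite.eventually hτ.compl_mem_cofinite
    rw [Nat.cofinite_eq_atTop] at this
    filter_upwards [this] with l hl
    have hl : τ (x + l) = x + l := not_not.1 hl
    rw [Equiv.Perm.mul_apply, Equiv.Perm.mul_apply, intShift_pow_apply, hl,
      intShift_pow_inv_apply]
    simp

/-! ### Ping-pong for the shift of `ℤ` -/

/-- Two infinite coinfinite sets of integers admit a permutation that maps the complement of one
onto the other. -/
theorem Equiv.Perm.exists_mapsTo_compl {M : Type*} [Countable M] {A R : Set M} (hA : A.Infinite)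
    (hR : R.Infinite) (hd : _root_.Disjoint A R) :
    ∃ x : Equiv.Perm M, (∀ y ∉ R, x y ∈ A) ∧ ∀ y ∉ A, x⁻¹ y ∈ R := by
  classical
  have := hA.to_subtype
  have := hR.to_subtype
  have : Infinite (Rᶜ : Set M) := (hA.mono (subset_compl_iff_disjoint_right.2 hd)).to_subtype
  have : Infinite (Aᶜ : Set M) := (hR.mono (subset_compl_iff_disjoint_left.2 hd)).to_subtype
  obtain ⟨e⟩ := nonempty_equiv_of_countable (α := R) (β := (Aᶜ : Set M))
  obtain ⟨f⟩ := nonempty_equiv_of_countable (α := (Rᶜ : Set M)) (β := A)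
  let x : Equiv.Perm M := (Equiv.Set.sumCompl R).symm.trans
    (((Equiv.sumComm _ _).trans (Equiv.sumCongr f e)).trans (Equiv.Set.sumCompl A))
  have hx : ∀ y (h : y ∉ R), x y = f ⟨y, h⟩ := fun y h => by
    simp [x, Equiv.Set.sumCompl_symm_apply_of_notMem h]
  refine ⟨x, fun y hy => hx y hy ▸ (f _).2, fun y hy => ?_⟩
  -- The second inclusion is the contrapositive of the first, applied at `x⁻¹ y`.
  by_contra h
  apply hy
  have := hx _ h
  rw [← Equiv.Perm.mul_apply, mul_inv_cancel, Equiv.Perm.one_apply] at this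
  rw [this]
  exact (f _).2

theorem noMixedIdentity_intShift : NoMixedIdentity intShift := by
  refine NoMixedIdentity.of_pingPong (MonoidHom.id _) fun N hN => ?_
  have hN' : (0 : ℤ) < N := by exact_mod_cast hN
  -- `P` is `N ℤ`, which a shift by `0 < k < N` moves off itself. It splits into three classes
  -- modulo `3 N`: two serve as the sets `T b`, and the third contains the base point `0`.
  let T : Bool → Set ℤ := fun b => range fun m : ℤ => N * (3 * m + cond b 1 2)
  have hT : ∀ b, (T b).Infinite := fun b => infinite_range_of_injective fun m n h => by
    have := mul_left_cancel₀ hN'.ne' h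
    omega
  have hd : Disjoint (T true) (T false) := by
    refine disjoint_left.2 ?_
    rintro _ ⟨m, rfl⟩ ⟨n, h⟩
    have := mul_left_cancel₀ hN'.ne' h
    simp only [cond_true, cond_false] at this
    omega
  obtain ⟨x, hx, hx'⟩ := Equiv.Perm.exists_mapsTo_compl (hT true) (hT false) hd
  refine ⟨x, {n | (N : ℤ) ∣ n}, T, 0, ?_, hd, dvd_zero _, ?_, hx, hx', ?_⟩
  · rintro b _ ⟨m, rfl⟩
    exact dvd_mul_right _ _
  · rintro b ⟨m, h⟩
    rcases mul_eq_zero.1 h with h | h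
    · omega
    · cases b
      · simp only [cond_false] at h; omega
      · simp only [cond_true] at h; omega
  · intro k hk hkN y hy h
    rw [MonoidHom.id_apply, intShift_pow_apply] at h
    have := Int.le_of_dvd (by omega) ((Int.dvd_add_right hy).1 h)
    omega

/-! ### The group `Aut(ℚ, <)` -/

/-- The pointwise maximum of two order automorphisms. -/
def OrderIso.maxIso {α : Type*} [LinearOrder α] (f g : α ≃o α) : α ≃o α :=
  StrictMono.orderIsoOfRightInverse (fun x => max (f x) (g x))
    (fun _ _ h => max_lt_max (f.strictMono h) (g.strictMono h))
    (fun y => min (f.symm y) (g.symm y)) fun y => by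
      rcases le_total (f.symm y) (g.symm y) with h | h
      · have : g (f.symm y) ≤ y := by simpa using g.monotone h
        simp [h, this]
      · have : f (g.symm y) ≤ y := by simpa using f.monotone h
        simp [h, this]

/-- The pointwise minimum of two order automorphisms. -/
def OrderIso.minIso {α : Type*} [LinearOrder α] (f g : α ≃o α) : α ≃o α :=
  StrictMono.orderIsoOfRightInverse (fun x => min (f x) (g x))
    (fun _ _ h => min_lt_min (f.strictMono h) (g.strictMono h))
    (fun y => max (f.symm y) (g.symm y)) fun y => by
      rcases le_total (f.symm y) (g.symm y) with h | h
      · have : y ≤ f (g.symm y) := by simpa using f.monotone h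
        simp [h, this]
      · have : y ≤ g (f.symm y) := by simpa using g.monotone h
        simp [h, this]

theorem OrderIso.exists_bump (c e : ℚ) : ∃ k : ℚ ≃o ℚ, (∀ x, x ≤ k x) ∧
    (∃ a b : ℚ, ∀ x ∉ Icc a b, k x = x) ∧ e ≤ k c := by
  rcases le_total e c with h | h
  · exact ⟨1, fun x => le_rfl, ⟨0, 0, fun x _ => rfl⟩, h⟩
  -- The bump is the tent with vertices `(c - 1, c - 1)`, `(c, e)` and `(e + 1, e + 1)`: the lines
  -- `k1` and `k2` through these points have slopes `s` and `s⁻¹`, and the maximum with the identity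
  -- cuts them off outside `[c - 1, e + 1]`.
  set s : ℚ := e - c + 1 with hs
  have hs1 : 1 ≤ s := by linarith
  have hs0 : 0 < s := by linarith
  have hsi : 0 < s⁻¹ := inv_pos.2 hs0
  have hsi1 : s⁻¹ ≤ 1 := inv_le_one_of_one_le₀ hs1
  let k1 : ℚ ≃o ℚ := (OrderIso.mulLeft₀ s hs0).trans (OrderIso.addRight (c - 1 - s * (c - 1)))
  let k2 : ℚ ≃o ℚ := (OrderIso.mulLeft₀ s⁻¹ hsi).trans (OrderIso.addRight (e - s⁻¹ * c))
  have h1 : ∀ x, k1 x = c - 1 + s * (x - (c - 1)) := fun x => by simp [k1]; ring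
  have h2 : ∀ x, k2 x = e + s⁻¹ * (x - c) := fun x => by simp [k2]; ring
  have h2' : ∀ x, k2 x = e + 1 + s⁻¹ * (x - (e + 1)) := fun x => by
    rw [h2]
    have : s⁻¹ * s = 1 := inv_mul_cancel₀ hs0.ne'
    linear_combination this - s⁻¹ * hs
  let k := OrderIso.maxIso (OrderIso.refl ℚ) (OrderIso.minIso k1 k2)
  have hk : ∀ x, k x = max x (min (k1 x) (k2 x)) := fun x => rfl
  refine ⟨k, fun x => le_max_left _ _, ⟨c - 1, e + 1, fun x hx => ?_⟩, ?_⟩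
  · rw [hk]
    refine max_eq_left ?_
    rcases lt_or_ge x (c - 1) with hxc | hxc
    · refine (min_le_left _ _).trans ?_
      rw [h1]
      nlinarith
    · have hxe : e + 1 < x := not_le.1 fun h' => hx ⟨hxc, h'⟩
      refine (min_le_right _ _).trans ?_
      rw [h2']
      nlinarith
  · rw [hk]
    refine le_max_of_le_right (le_min ?_ ?_)
    · rw [h1]; linarith
    · rw [h2]; linarith

/-- Clamp `f` between `k⁻¹` and `k` for a bump `k` that carries a lower bound of `W ∪ f(W)` beyond
an upper bound. The clamp is inactive on `W` and yields the identity wherever `k` is the identity.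
-/
theorem OrderIso.exists_bounded_support_eqOn (f : ℚ ≃o ℚ) (W : Finset ℚ) : ∃ τ : ℚ ≃o ℚ,
    (∃ a b : ℚ, ∀ x ∉ Icc a b, τ x = x) ∧ ∀ x ∈ W, τ x = f x := by
  classical
  obtain ⟨c, hc⟩ := (W ∪ W.image f).bddBelow
  obtain ⟨e, he⟩ := (W ∪ W.image f).bddAbove
  obtain ⟨k, hk, ⟨a, b, hab⟩, hke⟩ := OrderIso.exists_bump c e
  let τ := OrderIso.maxIso (OrderIso.minIso f k) k.symm
  have hτ : ∀ x, τ x = max (min (f x) (k x)) (k.symm x) := fun x => rfl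
  refine ⟨τ, ⟨a, b, fun x hx => ?_⟩, fun x hx => ?_⟩
  · have h1 := hab x hx
    have h2 : k.symm x = x := by rw [OrderIso.symm_apply_eq, h1]
    rw [hτ, h1, h2]
    exact max_eq_right (min_le_right _ _)
  · have hx1 : x ∈ ((W ∪ W.image f : Finset ℚ) : Set ℚ) := by simp [hx]
    have hx2 : f x ∈ ((W ∪ W.image f : Finset ℚ) : Set ℚ) := by
      simp only [Finset.coe_union, Finset.coe_image, mem_union, mem_image]
      exact Or.inr ⟨x, hx, rfl⟩
    have h1 : f x ≤ k x := (he hx2).trans (hke.trans (k.monotone (hc hx1)))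
    have h2 : k.symm x ≤ f x := by
      rw [OrderIso.symm_apply_le]
      exact (he hx1).trans (hke.trans (k.monotone (hc hx2)))
    rw [hτ, min_eq_left h1, max_eq_left h2]

theorem ratShift_pow_apply (q : ℚ) (l : ℕ) (x : ℚ) : (ratShift q ^ l) x = x + l * q := by
  induction l generalizing x with
  | zero => simp
  | succ l ih =>
    rw [pow_succ, RelIso.mul_apply, ih]
    simp [ratShift]
    ring

theorem ratShift_pow_inv_apply (q : ℚ) (l : ℕ) (x : ℚ) : (ratShift q ^ l)⁻¹ x = x - l * q := by
  apply (ratShift q ^ l).injective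
  rw [RelIso.apply_inv_self, ratShift_pow_apply]
  ring

theorem eventually_add_mul_notMem_Icc {q : ℚ} (hq : q ≠ 0) (x a b : ℚ) :
    ∀ᶠ l : ℕ in atTop, x + l * q ∉ Icc a b := by
  obtain ⟨n, hn⟩ := exists_nat_gt ((|a| + |b| + |x|) / |q|)
  filter_upwards [eventually_ge_atTop n] with l hl hmem
  have hq' : 0 < |q| := abs_pos.2 hq
  have h1 : |a| + |b| + |x| < n * |q| := (div_lt_iff₀ hq').1 hn
  have h2 : (n : ℚ) * |q| ≤ l * |q| :=
    mul_le_mul_of_nonneg_right (by exact_mod_cast hl) hq'.le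
  have h3 : (l : ℚ) * |q| = |(l : ℚ) * q| := by rw [abs_mul, Nat.abs_cast]
  have h4 : |(l : ℚ) * q| ≤ |x + l * q| + |x| := by
    have := abs_sub (x + l * q) x
    simpa using this
  have h5 : |x + l * q| ≤ |a| + |b| := by
    refine abs_le.2 ⟨?_, ?_⟩
    · linarith [hmem.1, neg_abs_le a, abs_nonneg b]
    · linarith [hmem.2, le_abs_self b, abs_nonneg a]
  linarith

theorem OrderIso.isInducing_toPerm : IsInducing fun f : ℚ ≃o ℚ => (f.toEquiv : Equiv.Perm ℚ) :=
  ⟨rfl⟩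

theorem OrderIso.tendsto_iff_eventually_eq {α : Type*} {F : Filter α} {f : α → ℚ ≃o ℚ}
    {σ : ℚ ≃o ℚ} : Tendsto f F (𝓝 σ) ↔ ∀ x, ∀ᶠ a in F, f a x = σ x := by
  rw [OrderIso.isInducing_toPerm.tendsto_nhds_iff, Equiv.Perm.tendsto_iff_eventually_eq]
  rfl

theorem conjMixing_ratShift {q : ℚ} (hq : q ≠ 0) : ConjMixing (ratShift q) := by
  refine ConjMixing.of_dense_homoclinic fun σ => mem_closure_iff_nhds.2 fun U hU => ?_
  rw [OrderIso.isInducing_toPerm.nhds_eq_comap] at hU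
  obtain ⟨V, hV, hVU⟩ := mem_comap.1 hU
  obtain ⟨W, hW⟩ := Equiv.Perm.exists_finset_of_mem_nhds hV
  obtain ⟨τ, ⟨a, b, hτ⟩, h⟩ := σ.exists_bounded_support_eqOn W
  refine ⟨τ, hVU (hW _ h), ?_, ?_⟩
  · refine OrderIso.tendsto_iff_eventually_eq.2 fun x => ?_
    filter_upwards [eventually_add_mul_notMem_Icc (neg_ne_zero.2 hq) x a b] with l hl
    have hl' : τ (x - l * q) = x - l * q := hτ _ (by simpa [sub_eq_add_neg] using hl)
    rw [RelIso.mul_apply, RelIso.mul_apply, ratShift_pow_inv_apply, hl', ratShift_pow_apply]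
    simp
  · refine OrderIso.tendsto_iff_eventually_eq.2 fun x => ?_
    filter_upwards [eventually_add_mul_notMem_Icc hq x a b] with l hl
    rw [RelIso.mul_apply, RelIso.mul_apply, ratShift_pow_apply, hτ _ hl, ratShift_pow_inv_apply]
    simp

/-! ### Ping-pong for the shifts of `ℚ`, by an automorphism periodic modulo `N` -/

theorem Rat.exists_eq_add_mul_floor (N : ℕ) (hN : 0 < N) (t : ℚ) :
    ∃ (m : ℤ) (s : ℚ), 0 ≤ s ∧ s < N ∧ t = N * m + s := by
  have hN' : (0 : ℚ) < N := by exact_mod_cast hN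
  refine ⟨⌊t / N⌋, t - N * ⌊t / N⌋, ?_, ?_, by ring⟩
  · have := (le_div_iff₀ hN').1 (Int.floor_le (t / N))
    linarith
  · have := (div_lt_iff₀ hN').1 (Int.lt_floor_add_one (t / N))
    linarith

/-- The map of `[0, N)` onto `[1, N + 1)` with slope `3 N - 1` on `[0, 1/3)` and slope
`1 / (3 N - 1)` on `[1/3, N)`. -/
def pingPongProfile (N : ℕ) (s : ℚ) : ℚ :=
  if s < 1 / 3 then 1 + (3 * N - 1) * s else N + 2 / 3 + (s - 1 / 3) / (3 * N - 1)

/-- The extension of `pingPongProfile N` to `ℚ` that commutes with the translation by `N`. -/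
def pingPongFun (N : ℕ) (t : ℚ) : ℚ := N * ⌊t / N⌋ + pingPongProfile N (t - N * ⌊t / N⌋)

theorem floor_add_mul_div {N : ℕ} (hN : 0 < N) (m : ℤ) {s : ℚ} (h0 : 0 ≤ s) (h1 : s < N) :
    ⌊((N : ℚ) * m + s) / N⌋ = m := by
  have hN' : (0 : ℚ) < N := by exact_mod_cast hN
  rw [Int.floor_eq_iff]
  constructor
  · rw [le_div_iff₀ hN']; linarith
  · rw [div_lt_iff₀ hN']; linarith

theorem pingPongFun_apply {N : ℕ} (hN : 0 < N) (m : ℤ) {s : ℚ} (h0 : 0 ≤ s) (h1 : s < N) :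
    pingPongFun N (N * m + s) = N * m + pingPongProfile N s := by
  rw [pingPongFun, floor_add_mul_div hN m h0 h1]
  simp

theorem pingPongProfile_of_lt {N : ℕ} {s : ℚ} (h : s < 1 / 3) :
    pingPongProfile N s = 1 + (3 * N - 1) * s := if_pos h

theorem pingPongProfile_of_ge {N : ℕ} {s : ℚ} (h : 1 / 3 ≤ s) :
    pingPongProfile N s = N + 2 / 3 + (s - 1 / 3) / (3 * N - 1) := if_neg h.not_gt

theorem pingPongProfile_lt_of_lt {N : ℕ} (hN : 0 < N) {s : ℚ} (h : s < 1 / 3) :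
    pingPongProfile N s < N + 2 / 3 := by
  have hN' : (1 : ℚ) ≤ N := by exact_mod_cast hN
  rw [pingPongProfile_of_lt h]
  nlinarith

theorem pingPongProfile_mem_Ico_of_ge {N : ℕ} (hN : 0 < N) {s : ℚ} (h : 1 / 3 ≤ s) (h1 : s < N) :
    pingPongProfile N s ∈ Ico ((N : ℚ) + 2 / 3) (N + 1) := by
  have hN' : (1 : ℚ) ≤ N := by exact_mod_cast hN
  have hd : (0 : ℚ) < 3 * N - 1 := by linarith
  rw [pingPongProfile_of_ge h]
  have h2 : 0 ≤ (s - 1 / 3) / (3 * N - 1) := div_nonneg (by linarith) hd.le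
  have h3 : (s - 1 / 3) / (3 * N - 1) < 1 / 3 := by rw [div_lt_iff₀ hd]; linarith
  exact ⟨by linarith, by linarith⟩

theorem pingPongProfile_mem_Ico {N : ℕ} (hN : 0 < N) {s : ℚ} (h0 : 0 ≤ s) (h1 : s < N) :
    pingPongProfile N s ∈ Ico (1 : ℚ) (N + 1) := by
  have hN' : (1 : ℚ) ≤ N := by exact_mod_cast hN
  rcases lt_or_ge s (1 / 3) with h | h
  · refine ⟨?_, (pingPongProfile_lt_of_lt hN h).trans (by linarith)⟩
    rw [pingPongProfile_of_lt h]
    nlinarith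
  · have := pingPongProfile_mem_Ico_of_ge hN h h1
    exact ⟨by linarith [this.1], this.2⟩

theorem pingPongProfile_lt {N : ℕ} (hN : 0 < N) {s t : ℚ} (hst : s < t) (h1 : t < N) :
    pingPongProfile N s < pingPongProfile N t := by
  have hN' : (1 : ℚ) ≤ N := by exact_mod_cast hN
  have hd : (0 : ℚ) < 3 * N - 1 := by linarith
  rcases lt_or_ge t (1 / 3) with h | h
  · rw [pingPongProfile_of_lt h, pingPongProfile_of_lt (hst.trans h)]
    nlinarith
  · rcases lt_or_ge s (1 / 3) with h' | h'
    · exact (pingPongProfile_lt_of_lt hN h').trans_le (pingPongProfile_mem_Ico_of_ge hN h h1).1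
    · rw [pingPongProfile_of_ge h, pingPongProfile_of_ge h']
      gcongr

theorem exists_pingPongProfile_eq {N : ℕ} (hN : 0 < N) {r : ℚ} (h0 : 1 ≤ r) (h1 : r < N + 1) :
    ∃ s : ℚ, 0 ≤ s ∧ s < N ∧ pingPongProfile N s = r := by
  have hN' : (1 : ℚ) ≤ N := by exact_mod_cast hN
  have hd : (0 : ℚ) < 3 * N - 1 := by linarith
  rcases lt_or_ge r (N + 2 / 3) with h | h
  · have h2 : (r - 1) / (3 * N - 1) < 1 / 3 := by rw [div_lt_iff₀ hd]; linarith
    refine ⟨(r - 1) / (3 * N - 1), div_nonneg (by linarith) hd.le, by linarith, ?_⟩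
    rw [pingPongProfile_of_lt h2]
    field_simp
    ring
  · have h2 : 0 ≤ (r - (N + 2 / 3)) * (3 * N - 1) := mul_nonneg (by linarith) hd.le
    refine ⟨1 / 3 + (r - (N + 2 / 3)) * (3 * N - 1), by linarith, by nlinarith, ?_⟩
    rw [pingPongProfile_of_ge (by linarith), add_sub_cancel_left, mul_div_cancel_right₀ _ hd.ne']
    ring

theorem pingPongFun_strictMono {N : ℕ} (hN : 0 < N) : StrictMono (pingPongFun N) := by
  intro t u htu
  have hN' : (1 : ℚ) ≤ N := by exact_mod_cast hN
  obtain ⟨m, s, hs0, hs1, rfl⟩ := Rat.exists_eq_add_mul_floor N hN t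
  obtain ⟨n, r, hr0, hr1, rfl⟩ := Rat.exists_eq_add_mul_floor N hN u
  rw [pingPongFun_apply hN m hs0 hs1, pingPongFun_apply hN n hr0 hr1]
  rcases lt_trichotomy m n with h | rfl | h
  · have h1 := (pingPongProfile_mem_Ico hN hs0 hs1).2
    have h2 := (pingPongProfile_mem_Ico hN hr0 hr1).1
    have h3 : (m : ℚ) + 1 ≤ n := by exact_mod_cast h
    nlinarith
  · have := pingPongProfile_lt hN (s := s) (t := r) (by linarith) hr1
    linarith
  · have h3 : (n : ℚ) + 1 ≤ m := by exact_mod_cast h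
    nlinarith

theorem pingPongFun_surjective {N : ℕ} (hN : 0 < N) : Function.Surjective (pingPongFun N) := by
  intro y
  obtain ⟨m, s, hs0, hs1, hy⟩ := Rat.exists_eq_add_mul_floor N hN (y - 1)
  obtain ⟨r, hr0, hr1, hr⟩ :=
    exists_pingPongProfile_eq hN (r := 1 + s) (by linarith) (by linarith)
  refine ⟨N * m + r, ?_⟩
  rw [pingPongFun_apply hN m hr0 hr1, hr]
  linarith

/-- Modulo `N`, `P` is `[0, 1)`, which the shifts by `0 < k < N` move off itself, while `T false`
and `T true` are its first and last thirds and `1 / 2` is the base point. The steep piece of the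
profile lives on the first third, so all the rest of the period is squeezed into `[N + 2/3, N + 1)`,
the last third modulo `N`. -/
theorem noMixedIdentity_ratShift_one : NoMixedIdentity (ratShift 1) := by
  let φ : (ℚ ≃o ℚ) →* Equiv.Perm ℚ := MonoidHom.mk' (fun f => f.toEquiv) fun _ _ => rfl
  refine NoMixedIdentity.of_pingPong φ fun N hN => ?_
  have hN' : (1 : ℚ) ≤ N := by exact_mod_cast hN
  let x : ℚ ≃o ℚ := (pingPongFun_strictMono hN).orderIsoOfSurjective _ (pingPongFun_surjective hN)
  let S : ℚ → ℚ → Set ℚ := fun a b => {t | ∃ (m : ℤ) (s : ℚ), a ≤ s ∧ s < b ∧ t = N * m + s}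
  have huniq : ∀ (m n : ℤ) (s r : ℚ), 0 ≤ s → s < N → 0 ≤ r → r < N →
      (N : ℚ) * m + s = N * n + r → s = r := by
    intro m n s r hs0 hs1 hr0 hr1 h
    have h1 := floor_add_mul_div hN m hs0 hs1
    rw [h, floor_add_mul_div hN n hr0 hr1] at h1
    subst h1
    linarith
  have hx : ∀ y ∉ S 0 (1 / 3), φ x y ∈ S (2 / 3) 1 := by
    intro y hy
    obtain ⟨m, s, hs0, hs1, rfl⟩ := Rat.exists_eq_add_mul_floor N hN y
    have hs : 1 / 3 ≤ s := not_lt.1 fun h => hy ⟨m, s, hs0, h, rfl⟩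
    have h := pingPongProfile_mem_Ico_of_ge hN hs hs1
    refine ⟨m + 1, pingPongProfile N s - N, by linarith [h.1], by linarith [h.2], ?_⟩
    change pingPongFun N _ = _
    rw [pingPongFun_apply hN m hs0 hs1]
    push_cast
    ring
  refine ⟨x, S 0 1, fun b => cond b (S (2 / 3) 1) (S 0 (1 / 3)), 1 / 2, ?_, ?_, ?_, ?_, hx, ?_, ?_⟩
  · rintro (_ | _) _ ⟨m, s, hs0, hs1, rfl⟩
    · exact ⟨m, s, hs0, by linarith, rfl⟩
    · exact ⟨m, s, by linarith, hs1, rfl⟩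
  · refine disjoint_left.2 ?_
    rintro _ ⟨m, s, hs0, hs1, rfl⟩ ⟨n, r, hr0, hr1, h⟩
    have := huniq m n s r (by linarith) (by linarith) hr0 (by linarith) h
    linarith
  · exact ⟨0, 1 / 2, by norm_num, by norm_num, by simp⟩
  · have key : ∀ (m : ℤ) (s : ℚ), 0 ≤ s → s < 1 → (1 / 2 : ℚ) = N * m + s → s = 1 / 2 := by
      intro m s h0 h1 h
      exact (huniq 0 m (1 / 2) s (by norm_num) (by linarith) h0 (by linarith)
        (by simpa using h)).symm
    rintro (_ | _) ⟨m, s, hs0, hs1, h⟩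
    · have := key m s hs0 (by linarith) h
      linarith
    · have := key m s (by linarith) hs1 h
      linarith
  · intro y hy
    by_contra h
    refine hy ?_
    have := hx _ h
    rwa [← Equiv.Perm.mul_apply, mul_inv_cancel, Equiv.Perm.one_apply] at this
  · rintro k hk hkN _ ⟨m, s, hs0, hs1, rfl⟩ ⟨n, r, hr0, hr1, h⟩
    have hk1 : (1 : ℚ) ≤ k := by exact_mod_cast hk
    have hk2 : (k : ℚ) + 1 ≤ N := by exact_mod_cast hkN
    rw [← map_pow] at h
    change (ratShift 1 ^ k) _ = _ at h
    rw [ratShift_pow_apply, mul_one, add_assoc] at h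
    have := huniq m n (s + k) r (by linarith) (by linarith) hr0 (by linarith) h
    linarith

/-- Conjugation by the multiplication by `q ≠ 0` on `Aut(ℚ, <)`. -/
def ratScaleConj (q : ℚ) (hq : q ≠ 0) : (ℚ ≃o ℚ) →* (ℚ ≃o ℚ) where
  toFun f :=
    { toEquiv := ((Equiv.mulLeft₀ q hq).symm.trans f.toEquiv).trans (Equiv.mulLeft₀ q hq)
      map_rel_iff' := by
        intro a b
        change q * f (q⁻¹ * a) ≤ q * f (q⁻¹ * b) ↔ a ≤ b
        -- For `q < 0` the order is reversed twice, so the conjugate still preserves it.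
        rcases hq.lt_or_gt with h | h
        · rw [mul_le_mul_left_of_neg h, f.le_iff_le, mul_le_mul_left_of_neg (inv_lt_zero.2 h)]
        · rw [mul_le_mul_iff_right₀ h, f.le_iff_le, mul_le_mul_iff_right₀ (inv_pos.2 h)] }
  map_one' := by
    ext x
    exact mul_inv_cancel_left₀ hq x
  map_mul' f g := by
    ext x
    change q * f (g (q⁻¹ * x)) = q * f (q⁻¹ * (q * g (q⁻¹ * x)))
    rw [inv_mul_cancel_left₀ hq]

theorem ratScaleConj_apply (q : ℚ) (hq : q ≠ 0) (f : ℚ ≃o ℚ) (x : ℚ) :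
    ratScaleConj q hq f x = q * f (q⁻¹ * x) := rfl

theorem noMixedIdentity_ratShift {q : ℚ} (hq : q ≠ 0) : NoMixedIdentity (ratShift q) := by
  have h : ratScaleConj q hq (ratShift 1) = ratShift q := by
    ext x
    rw [ratScaleConj_apply]
    simp only [ratShift, OrderIso.addRight_apply]
    rw [mul_add, mul_inv_cancel_left₀ hq, mul_one]
  rw [← h]
  refine noMixedIdentity_ratShift_one.map _ fun f g hfg => ?_
  ext x
  have := DFunLike.congr_fun hfg (q * x)
  rw [ratScaleConj_apply, ratScaleConj_apply, inv_mul_cancel_left₀ hq] at this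
  exact mul_left_cancel₀ hq this

/-! ### Homeomorphisms of `2 ^ ℤ` and cylinders -/

theorem Homeomorph.exists_finset_of_mem_nhds {σ : CantorZ ≃ₜ CantorZ}
    {U : Set (CantorZ ≃ₜ CantorZ)} (hU : U ∈ 𝓝 σ) :
    ∃ W : Finset ℤ, ∀ τ : CantorZ ≃ₜ CantorZ, (∀ i ∈ W, ∀ x, τ x i = σ x i) → τ ∈ U := by
  have hi : IsInducing fun h : CantorZ ≃ₜ CantorZ => (h : C(CantorZ, CantorZ)) := ⟨rfl⟩
  rw [hi.nhds_eq_comap] at hU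
  obtain ⟨V, hV, hVU⟩ := mem_comap.1 hU
  obtain ⟨V', hV', hVV'⟩ := (nhds_basis_uniformity
    ContinuousMap.hasBasis_compactConvergenceUniformity_of_compact).mem_iff.1 hV
  obtain ⟨W, hW⟩ := exists_finset_of_mem_uniformity hV'
  exact ⟨W, fun τ hτ => hVU (hVV' fun x => hW _ _ fun i hi => hτ i hi x)⟩

theorem Homeomorph.tendsto_of_eventually_apply_eq {α : Type*} {F : Filter α}
    {f : α → CantorZ ≃ₜ CantorZ} {σ : CantorZ ≃ₜ CantorZ}
    (h : ∀ i, ∀ᶠ a in F, ∀ x, f a x i = σ x i) : Tendsto f F (𝓝 σ) := by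
  intro U hU
  obtain ⟨W, hW⟩ := Homeomorph.exists_finset_of_mem_nhds hU
  have hall : ∀ᶠ a in F, ∀ i ∈ W, ∀ x, f a x i = σ x i :=
    (eventually_all_finset W).2 fun i _ => h i
  exact hall.mono fun a ha => hW _ ha

/-- By uniform continuity on a compact space, finitely many output digits depend on finitely many
input digits. -/
theorem Continuous.exists_finset_window {f : CantorZ → CantorZ} (hf : Continuous f)
    (W' : Finset ℤ) : ∃ W : Finset ℤ, W' ⊆ W ∧
      ∀ x y : CantorZ, (∀ i ∈ W, x i = y i) → ∀ i ∈ W', f x i = f y i := by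
  classical
  have hu := CompactSpace.uniformContinuous_of_continuous hf (cylinder_mem_uniformity W')
  obtain ⟨W, hW⟩ := exists_finset_of_mem_uniformity (mem_map.1 hu)
  exact ⟨W' ∪ W, Finset.subset_union_left,
    fun x y hxy => hW x y fun i hi => hxy i (Finset.mem_union_right _ hi)⟩

theorem bernoulliShift_pow_apply (l : ℕ) (x : CantorZ) (i : ℤ) :
    (bernoulliShift ^ l) x i = x (i + l) := by
  induction l generalizing x with
  | zero => simp
  | succ l ih =>
    rw [pow_succ, Homeomorph.mul_apply, ih]
    simp [bernoulliShift]
    ring_nf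

theorem bernoulliShift_pow_inv_apply (l : ℕ) (x : CantorZ) (i : ℤ) :
    (bernoulliShift ^ l)⁻¹ x i = x (i - l) := by
  obtain ⟨y, rfl⟩ := (bernoulliShift ^ l).surjective x
  rw [bernoulliShift_pow_apply, ← Homeomorph.mul_apply, inv_mul_cancel]
  simp

/-- The configuration that is `u` on the window `W` and `x` outside. -/
def windowGlue (W : Finset ℤ) (u : W → Bool) (x : CantorZ) : CantorZ :=
  fun i => if h : i ∈ W then u ⟨i, h⟩ else x i

theorem windowGlue_of_mem {W : Finset ℤ} (u : W → Bool) (x : CantorZ) {i : ℤ} (h : i ∈ W) :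
    windowGlue W u x i = u ⟨i, h⟩ := dif_pos h

theorem windowGlue_of_notMem {W : Finset ℤ} (u : W → Bool) (x : CantorZ) {i : ℤ} (h : i ∉ W) :
    windowGlue W u x i = x i := dif_neg h

theorem restrict_windowGlue (W : Finset ℤ) (u : W → Bool) (x : CantorZ) :
    W.restrict (windowGlue W u x) = u := by
  ext i
  exact windowGlue_of_mem u x i.2

theorem continuous_windowGlue (W : Finset ℤ) {f : CantorZ → W → Bool} (hf : Continuous f) :
    Continuous fun x => windowGlue W (f x) x := by
  refine continuous_pi fun i => ?_
  by_cases h : i ∈ W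
  · simp only [windowGlue_of_mem _ _ h]
    exact (continuous_apply _).comp hf
  · simp only [windowGlue_of_notMem _ _ h]
    exact continuous_apply i

theorem continuous_restrict_bool (W : Finset ℤ) :
    Continuous (W.restrict : CantorZ → W → Bool) :=
  continuous_pi fun i => continuous_apply i.1

/-! ### Homeomorphisms between finite multiples of the Cantor space -/

/-- Prepending a digit. -/
def cantorCons : Bool × (ℕ → Bool) ≃ₜ (ℕ → Bool) where
  toFun p n := Nat.casesOn n p.1 p.2
  invFun x := (x 0, fun n => x (n + 1))
  left_inv p := rfl
  right_inv x := by
    funext n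
    cases n <;> rfl
  continuous_toFun := continuous_pi fun n => by
    cases n with
    | zero => exact continuous_fst
    | succ n => exact (continuous_apply n).comp continuous_snd
  continuous_invFun := (continuous_apply 0).prodMk
    (continuous_pi fun n => continuous_apply (n + 1))

theorem nonempty_finProdCantor (n : ℕ) :
    Nonempty (Fin (n + 1) × (ℕ → Bool) ≃ₜ (ℕ → Bool)) := by
  induction n with
  | zero => exact ⟨Homeomorph.uniqueProd (Fin 1) _⟩
  | succ n ih =>
    obtain ⟨e⟩ := ih
    -- The first copy goes to the digit `false`; the remaining `n + 1` copies are merged by `e` and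
    -- go to the digit `true`.
    let E : Fin (n + 1 + 1) × (ℕ → Bool) ≃ₜ Bool × (ℕ → Bool) :=
      { toFun := fun p => Fin.cases (false, p.2) (fun i => (true, e (i, p.2))) p.1
        invFun := fun p => Bool.casesOn p.1 (0, p.2) ((e.symm p.2).1.succ, (e.symm p.2).2)
        left_inv := by
          rintro ⟨i, x⟩
          refine Fin.cases ?_ (fun i => ?_) i <;> simp
        right_inv := by
          rintro ⟨_ | _, x⟩ <;> simp
        continuous_toFun := by
          refine continuous_prod_of_discrete_left.2 fun i => ?_
          refine Fin.cases ?_ (fun i => ?_) i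
          · simp only [Fin.cases_zero]
            fun_prop
          · simp only [Fin.cases_succ]
            fun_prop
        continuous_invFun := by
          refine continuous_prod_of_discrete_left.2 fun b => ?_
          have hsucc : Continuous fun i : Fin (n + 1) => i.succ := continuous_of_discreteTopology
          have he : Continuous e.symm := e.symm.continuous
          cases b
          · exact Continuous.prodMk_right 0
          · exact (hsucc.comp (continuous_fst.comp he)).prodMk (continuous_snd.comp he) }
    exact ⟨E.trans cantorCons⟩

theorem nonempty_finiteProdCantor (F : Type*) [Finite F] [Nonempty F] [TopologicalSpace F]
    [DiscreteTopology F] : Nonempty (F × (ℕ → Bool) ≃ₜ (ℕ → Bool)) := by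
  obtain ⟨n, ⟨e⟩⟩ := Finite.exists_equiv_fin F
  obtain _ | n := n
  · exact (e (Classical.arbitrary F)).elim0
  obtain ⟨E⟩ := nonempty_finProdCantor n
  let e' : F ≃ₜ Fin (n + 1) := ⟨e, continuous_of_discreteTopology, continuous_of_discreteTopology⟩
  exact ⟨(e'.prodCongr (Homeomorph.refl _)).trans E⟩

/-- A surjection `f : S → A` of finite sets lifts to a homeomorphism `S × 2 ^ ℕ ≃ A × 2 ^ ℕ`. -/
theorem exists_homeomorph_prodCantor {S A : Type*} [Finite S] [TopologicalSpace S]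
    [DiscreteTopology S] [TopologicalSpace A] [DiscreteTopology A] (f : S → A)
    (hf : Function.Surjective f) :
    ∃ e : S × (ℕ → Bool) ≃ₜ A × (ℕ → Bool), ∀ q, (e q).1 = f q.1 := by
  -- Each fibre of `f` is finite and nonempty, so its product with the Cantor space is again a
  -- Cantor space; these identifications are glued over `A`.
  have : ∀ a, Nonempty ({s // f s = a} × (ℕ → Bool) ≃ₜ (ℕ → Bool)) := by
    intro a
    obtain ⟨s, hs⟩ := hf a
    have : Nonempty {s // f s = a} := ⟨⟨s, hs⟩⟩
    exact nonempty_finiteProdCantor _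
  let e := fun a => (this a).some
  have key : ∀ (a : A) (t : {s // f s = a}) (x : ℕ → Bool),
      e (f t.1) (⟨t.1, rfl⟩, x) = e a (t, x) := by
    rintro _ ⟨s, rfl⟩ x
    rfl
  refine ⟨⟨⟨fun q => (f q.1, e (f q.1) (⟨q.1, rfl⟩, q.2)),
    fun q => (((e q.1).symm q.2).1.1, ((e q.1).symm q.2).2), ?_, ?_⟩, ?_, ?_⟩, fun q => rfl⟩
  · rintro ⟨s, x⟩
    simp
  · rintro ⟨a, x⟩
    refine Prod.ext ((e a).symm x).1.2 ?_
    simp only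
    rw [key a]
    simp
  · exact continuous_prod_of_discrete_left.2 fun s =>
      (continuous_const (y := f s)).prodMk
        ((e (f s)).continuous.comp (Continuous.prodMk_right (⟨s, rfl⟩ : {t // f t = f s})))
  · exact continuous_prod_of_discrete_left.2 fun a =>
      (continuous_subtype_val.comp (continuous_fst.comp (e a).symm.continuous)).prodMk
        (continuous_snd.comp (e a).symm.continuous)

/-- Split `2 ^ ℤ` into the words on `W` and a Cantor space of remaining digits. Up to homeomorphism,
both `p` and `f` then become the projection `A × 2 ^ ℕ → A`, and `h` composes one identification
with the inverse of the other. -/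
theorem exists_homeomorph_comp_eq {A : Type*} (p f : CantorZ → A)
    (hp : Function.Surjective p) (hf : Function.Surjective f) (W : Finset ℤ)
    (hpW : ∀ x y : CantorZ, (∀ i ∈ W, x i = y i) → p x = p y)
    (hfW : ∀ x y : CantorZ, (∀ i ∈ W, x i = y i) → f x = f y) :
    ∃ h : CantorZ ≃ₜ CantorZ, ∀ x, p (h x) = f x := by
  let _ : TopologicalSpace A := ⊥
  have _ : DiscreteTopology A := ⟨rfl⟩
  have : Infinite {i : ℤ // i ∉ W} := (W.finite_toSet.infinite_compl).to_subtype
  obtain ⟨d⟩ := nonempty_equiv_of_countable (α := {i : ℤ // i ∉ W}) (β := ℕ)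
  let s : CantorZ ≃ₜ (W → Bool) × (ℕ → Bool) :=
    (Homeomorph.piEquivPiSubtypeProd (fun i => i ∈ W) (fun _ => Bool)).trans
      ((Homeomorph.refl _).prodCongr (Homeomorph.piCongrLeft (Y := fun _ => Bool) d))
  have hs : ∀ x, (s x).1 = W.restrict x := fun x => rfl
  have hbar : ∀ q : CantorZ → A, (∀ x y : CantorZ, (∀ i ∈ W, x i = y i) → q x = q y) →
      ∀ x, q (windowGlue W (W.restrict x) fun _ => false) = q x := by
    intro q hq x
    refine hq _ _ fun i hi => ?_
    rw [windowGlue_of_mem _ _ hi]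
    rfl
  have hlift : ∀ q : CantorZ → A, Function.Surjective q →
      (∀ x y : CantorZ, (∀ i ∈ W, x i = y i) → q x = q y) →
      ∃ e : (W → Bool) × (ℕ → Bool) ≃ₜ A × (ℕ → Bool), ∀ x, (e (s x)).1 = q x := by
    intro q hq hqW
    obtain ⟨e, he⟩ := exists_homeomorph_prodCantor
      (fun u : W → Bool => q (windowGlue W u fun _ => false)) fun a => by
        obtain ⟨x, rfl⟩ := hq a
        exact ⟨_, hbar q hqW x⟩
    exact ⟨e, fun x => by rw [he, hs, hbar q hqW]⟩
  obtain ⟨ep, hep⟩ := hlift p hp hpW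
  obtain ⟨ef, hef⟩ := hlift f hf hfW
  refine ⟨((s.trans ef).trans ep.symm).trans s.symm, fun x => ?_⟩
  rw [← hep, ← hef]
  simp

/-! ### The group `H(2 ^ ℤ)` -/

theorem surjective_window_pair {σ τ : CantorZ → CantorZ} (hσ : Function.Surjective σ)
    (hτ : Function.Surjective τ) {W W' : Finset ℤ}
    (hσW : ∀ x y : CantorZ, (∀ i ∈ W, x i = y i) → ∀ i ∈ W', σ x i = σ y i)
    (hτW : ∀ x y : CantorZ, (∀ i ∈ W, x i = y i) → ∀ i ∈ W', τ x i = τ y i)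
    {l : ℕ} (hl : ∀ i ∈ W, i + (l : ℤ) ∉ W) :
    Function.Surjective fun x : CantorZ =>
      ((W'.restrict (σ x), W'.restrict (τ ((bernoulliShift ^ l) x))) :
        (W' → Bool) × (W' → Bool)) := by
  rintro ⟨a, b⟩
  obtain ⟨x, hx⟩ := hσ (windowGlue W' a fun _ => false)
  obtain ⟨y, hy⟩ := hτ (windowGlue W' b fun _ => false)
  -- The two requirements read the digits in `W` and in `W + l`, which are disjoint, so preimages
  -- for each can be glued.
  refine ⟨windowGlue W (W.restrict x) ((bernoulliShift ^ l)⁻¹ y), Prod.ext ?_ ?_⟩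
  · rw [← restrict_windowGlue W' a fun _ => false, ← hx]
    ext i
    refine hσW _ _ (fun j hj => ?_) i i.2
    rw [windowGlue_of_mem _ _ hj]
    rfl
  · rw [← restrict_windowGlue W' b fun _ => false, ← hy]
    ext i
    refine hτW _ _ (fun j hj => ?_) i i.2
    rw [bernoulliShift_pow_apply, windowGlue_of_notMem _ _ (hl j hj),
      bernoulliShift_pow_inv_apply, add_sub_cancel_right]

theorem eventually_forall_add_notMem (W : Finset ℤ) :
    ∀ᶠ l : ℕ in atTop, ∀ i ∈ W, i + (l : ℤ) ∉ W := by
  refine (eventually_all_finset W).2 fun i _ => ?_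
  have hinj : Function.Injective fun l : ℕ => i + (l : ℤ) := fun a b hab => by simpa using hab
  have := hinj.tendsto_cofinite.eventually W.finite_toSet.compl_mem_cofinite
  rwa [Nat.cofinite_eq_atTop] at this

/-- With `S` the shift, it suffices that on `W'` the word of `h x` is that of `σ x`, and the word of
`S ^ l (h x)` is that of `τ (S ^ l x)`. This has the form `p ∘ h = f` with `p` and `f` surjective
once `l` separates the windows. Window permutations would not do here: they preserve `μ ^ ℤ`, so
they are not dense. -/
theorem conjMixing_bernoulliShift : ConjMixing bernoulliShift := by
  classical
  rintro U V hU ⟨σ, hσ⟩ hV ⟨τ, hτ⟩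
  obtain ⟨W₁, hW₁⟩ := Homeomorph.exists_finset_of_mem_nhds (hU.mem_nhds hσ)
  obtain ⟨W₂, hW₂⟩ := Homeomorph.exists_finset_of_mem_nhds (hV.mem_nhds hτ)
  set W' := W₁ ∪ W₂ with hW'
  obtain ⟨Wσ, hWσ', hWσ⟩ := σ.continuous.exists_finset_window W'
  obtain ⟨Wτ, -, hWτ⟩ := τ.continuous.exists_finset_window W'
  set W := Wσ ∪ Wτ with hW
  have hσW : ∀ x y : CantorZ, (∀ i ∈ W, x i = y i) → ∀ i ∈ W', σ x i = σ y i :=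
    fun x y h => hWσ x y fun i hi => h i (Finset.mem_union_left _ hi)
  have hτW : ∀ x y : CantorZ, (∀ i ∈ W, x i = y i) → ∀ i ∈ W', τ x i = τ y i :=
    fun x y h => hWτ x y fun i hi => h i (Finset.mem_union_right _ hi)
  have hidW : ∀ x y : CantorZ, (∀ i ∈ W, x i = y i) → ∀ i ∈ W', id x i = id y i :=
    fun x y h i hi => h i (Finset.mem_union_left _ (hWσ' hi))
  filter_upwards [eventually_forall_add_notMem W] with l hl
  have hdep : ∀ ρ κ : CantorZ → CantorZ,
      (∀ x y : CantorZ, (∀ i ∈ W, x i = y i) → ∀ i ∈ W', ρ x i = ρ y i) →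
      (∀ x y : CantorZ, (∀ i ∈ W, x i = y i) → ∀ i ∈ W', κ x i = κ y i) →
      ∀ x y : CantorZ, (∀ i ∈ W ∪ W.image (· + (l : ℤ)), x i = y i) →
        ((W'.restrict (ρ x), W'.restrict (κ ((bernoulliShift ^ l) x))) :
          (W' → Bool) × (W' → Bool)) =
        (W'.restrict (ρ y), W'.restrict (κ ((bernoulliShift ^ l) y))) := by
    intro ρ κ hρ hκ x y h
    refine Prod.ext ?_ ?_
    · ext i
      exact hρ x y (fun j hj => h j (Finset.mem_union_left _ hj)) i i.2
    · ext i
      refine hκ _ _ (fun j hj => ?_) i i.2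
      rw [bernoulliShift_pow_apply, bernoulliShift_pow_apply]
      exact h _ (Finset.mem_union_right _ (Finset.mem_image_of_mem _ hj))
  obtain ⟨h, hh⟩ := exists_homeomorph_comp_eq _ _
    (surjective_window_pair Function.surjective_id Function.surjective_id hidW hidW hl)
    (surjective_window_pair σ.surjective τ.surjective hσW hτW hl) _
    (hdep _ _ hidW hidW) (hdep _ _ hσW hτW)
  refine ⟨h, hW₁ h fun i hi x => ?_, hW₂ _ fun i hi x => ?_⟩
  · exact congrFun (congrArg Prod.fst (hh x)) ⟨i, Finset.mem_union_left _ hi⟩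
  · have := congrFun (congrArg Prod.snd (hh ((bernoulliShift ^ l)⁻¹ x)))
      ⟨i, Finset.mem_union_right _ hi⟩
    have hc : (bernoulliShift ^ l) ((bernoulliShift ^ l)⁻¹ x) = x := by
      rw [← Homeomorph.mul_apply, mul_inv_cancel, Homeomorph.one_apply]
    rw [hc] at this
    exact this

/-! ### The group `H(2 ^ ℤ, μ ^ ℤ)` -/

/-- Permutations of `ℤ` act on `2 ^ ℤ` by permuting the coordinates; the reflection of `ℤ` is built
in so that the shift of `ℤ` acts as the Bernoulli shift. -/
def coordPermHomeo (π : Equiv.Perm ℤ) : CantorZ ≃ₜ CantorZ where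
  toFun x i := x (-π.symm (-i))
  invFun x i := x (-π (-i))
  left_inv x := by funext i; simp
  right_inv x := by funext i; simp
  continuous_toFun := continuous_pi fun i => continuous_apply (-π.symm (-i))
  continuous_invFun := continuous_pi fun i => continuous_apply (-π (-i))

theorem coordPermHomeo_mem (π : Equiv.Perm ℤ) : coordPermHomeo π ∈ measurePreservingHomeo := by
  refine ⟨(coordPermHomeo π).continuous.measurable, ?_⟩
  have hinj : Function.Injective fun i : ℤ => -π.symm (-i) := fun i j h => by simpa using h
  exact Measure.map_infinitePi_infinitePi_of_inj (P := fun _ : ℤ => coinMeasure) hinj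

/-- The coordinate permutations, as a homomorphism `S_∞ → H(2 ^ ℤ, μ ^ ℤ)`. -/
def coordPerm : Equiv.Perm ℤ →* measurePreservingHomeo where
  toFun π := ⟨coordPermHomeo π, coordPermHomeo_mem π⟩
  map_one' := by
    ext x i
    change x (- -i) = x i
    rw [neg_neg]
  map_mul' π ρ := by
    ext x i
    change x (-ρ.symm (π.symm (-i))) = x (-ρ.symm (- -π.symm (-i)))
    rw [neg_neg]

theorem coordPerm_injective : Function.Injective coordPerm := by
  intro π ρ h
  have h2 : ∀ i, π.symm i = ρ.symm i := by
    intro i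
    have h1 : (coordPermHomeo π) (fun j => decide (j = -π.symm i)) (-i) =
        (coordPermHomeo ρ) (fun j => decide (j = -π.symm i)) (-i) := by
      have : coordPermHomeo π = coordPermHomeo ρ := congrArg Subtype.val h
      rw [this]
    have h1' : decide (-π.symm (- -i) = -π.symm i) = decide (-ρ.symm (- -i) = -π.symm i) := h1
    simpa [eq_comm] using h1'
  exact Equiv.symm_bijective.injective (Equiv.ext h2)

theorem coordPerm_intShift : coordPerm intShift = bernoulliShiftMP := by
  ext x i
  change x (-(-i - 1)) = x (i + 1)
  congr 1
  ring

/-- The shift of `ℤ` becomes the Bernoulli shift under the faithful action of `S_∞` on coordinates,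
so the ping-pong on `ℤ` is reused. -/
theorem noMixedIdentity_bernoulliShiftMP : NoMixedIdentity bernoulliShiftMP :=
  coordPerm_intShift ▸ noMixedIdentity_intShift.map coordPerm coordPerm_injective

theorem noMixedIdentity_bernoulliShift : NoMixedIdentity bernoulliShift :=
  noMixedIdentity_bernoulliShiftMP.map measurePreservingHomeo.subtype Subtype.val_injective

/-! ### Window permutations and their density among the measure-preserving homeomorphisms -/

/-- Flipping the digits in the set of indices `i` with `c i = true` preserves `μ ^ ℤ`. -/
theorem measurePreserving_xor (c : ℤ → Bool) :
    MeasurePreserving (fun (x : CantorZ) i => xor (c i) (x i)) bernoulliMeasure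
      bernoulliMeasure := by
  have hm : ∀ b : Bool, Measurable (xor b) := fun b => measurable_of_countable _
  have hcoin : ∀ b : Bool, coinMeasure.map (xor b) = coinMeasure := by
    intro b
    rw [coinMeasure, Measure.map_add _ _ (hm b), Measure.map_smul, Measure.map_smul,
      Measure.map_dirac, Measure.map_dirac]
    cases b
    · rfl
    · exact add_comm _ _
  refine ⟨measurable_pi_lambda _ fun i => (hm _).comp (measurable_pi_apply i), ?_⟩
  have := Measure.infinitePi_map_pi (fun _ : ℤ => coinMeasure) (fun i => hm (c i))
  simp only [hcoin] at this
  exact this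

/-- The homeomorphism that permutes the words on the window `W`. -/
def windowPerm (W : Finset ℤ) (π : Equiv.Perm (W → Bool)) : CantorZ ≃ₜ CantorZ where
  toFun x := windowGlue W (π (W.restrict x)) x
  invFun x := windowGlue W (π.symm (W.restrict x)) x
  left_inv x := by
    dsimp only
    rw [restrict_windowGlue, Equiv.symm_apply_apply]
    funext i
    by_cases h : i ∈ W
    · rw [windowGlue_of_mem _ _ h]; rfl
    · rw [windowGlue_of_notMem _ _ h, windowGlue_of_notMem _ _ h]
  right_inv x := by
    dsimp only
    rw [restrict_windowGlue, Equiv.apply_symm_apply]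
    funext i
    by_cases h : i ∈ W
    · rw [windowGlue_of_mem _ _ h]; rfl
    · rw [windowGlue_of_notMem _ _ h, windowGlue_of_notMem _ _ h]
  continuous_toFun := continuous_windowGlue W
    (continuous_of_discreteTopology.comp (continuous_restrict_bool W))
  continuous_invFun := continuous_windowGlue W
    (continuous_of_discreteTopology.comp (continuous_restrict_bool W))

/-- The flip that carries the cylinder of the word `u` to that of the word `v`. -/
def windowFlip (W : Finset ℤ) (u v : W → Bool) (x : CantorZ) : CantorZ :=
  fun i => xor (if h : i ∈ W then xor (u ⟨i, h⟩) (v ⟨i, h⟩) else false) (x i)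

theorem measurePreserving_windowFlip (W : Finset ℤ) (u v : W → Bool) :
    MeasurePreserving (windowFlip W u v) bernoulliMeasure bernoulliMeasure :=
  measurePreserving_xor _

theorem windowFlip_eq_windowGlue {W : Finset ℤ} {u : W → Bool} (v : W → Bool) {x : CantorZ}
    (hx : W.restrict x = u) : windowFlip W u v x = windowGlue W v x := by
  subst hx
  funext i
  by_cases h : i ∈ W
  · rw [windowGlue_of_mem _ _ h]
    simp only [windowFlip, dif_pos h, Finset.restrict]
    cases x i <;> cases v ⟨i, h⟩ <;> rfl
  · rw [windowGlue_of_notMem _ _ h]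
    simp [windowFlip, dif_neg h]

theorem restrict_windowFlip_eq_iff (W : Finset ℤ) (u v : W → Bool) (x : CantorZ) :
    W.restrict (windowFlip W u v x) = v ↔ W.restrict x = u := by
  constructor
  · intro h
    ext i
    have := congrFun h i
    simp only [Finset.restrict, windowFlip, dif_pos i.2] at this ⊢
    generalize x i = a at *
    generalize u i = b at *
    generalize v i = c at *
    revert this
    cases a <;> cases b <;> cases c <;> decide
  · intro h
    rw [windowFlip_eq_windowGlue v h, restrict_windowGlue]

theorem measurableSet_restrict_preimage (W : Finset ℤ) (s : Set (W → Bool)) :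
    MeasurableSet ((W.restrict : CantorZ → W → Bool) ⁻¹' s) :=
  (Finset.measurable_restrict W) s.toFinite.measurableSet

theorem measure_eq_sum_window (W : Finset ℤ) {s : Set CantorZ} :
    bernoulliMeasure s =
      ∑ u : W → Bool, bernoulliMeasure ((W.restrict : CantorZ → W → Bool) ⁻¹' {u} ∩ s) := by
  have h := sum_measure_preimage_singleton (μ := bernoulliMeasure.restrict s) Finset.univ
    (f := (W.restrict : CantorZ → W → Bool))
    fun u _ => measurableSet_restrict_preimage W {u}
  rw [Finset.coe_univ, preimage_univ, Measure.restrict_apply_univ] at h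
  rw [← h]
  exact Finset.sum_congr rfl fun u _ =>
    Measure.restrict_apply (measurableSet_restrict_preimage W {u})

/-- On each cylinder over `W` the map agrees with a digit flip, which preserves the measure. Summing
over cylinders, reindexed by `π`, gives the claim. -/
theorem windowPerm_mem (W : Finset ℤ) (π : Equiv.Perm (W → Bool)) :
    windowPerm W π ∈ measurePreservingHomeo := by
  have hm := (windowPerm W π).continuous.measurable
  refine ⟨hm, Measure.ext fun s hs => ?_⟩
  rw [Measure.map_apply hm hs, measure_eq_sum_window W, measure_eq_sum_window W (s := s),
    ← Equiv.sum_comp π fun u => bernoulliMeasure (_ ∩ s)]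
  refine Finset.sum_congr rfl fun u _ => ?_
  rw [← (measurePreserving_windowFlip W u (π u)).measure_preimage
    ((measurableSet_restrict_preimage W {π u}).inter hs).nullMeasurableSet]
  congr 1
  ext x
  simp only [mem_inter_iff, mem_preimage, mem_singleton_iff, restrict_windowFlip_eq_iff]
  refine and_congr_right fun hx => ?_
  rw [windowFlip_eq_windowGlue _ hx, ← hx]
  rfl

theorem measure_window_eq (W : Finset ℤ) (u v : W → Bool) :
    bernoulliMeasure ((W.restrict : CantorZ → W → Bool) ⁻¹' {u}) =
      bernoulliMeasure ((W.restrict : CantorZ → W → Bool) ⁻¹' {v}) := by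
  rw [← (measurePreserving_windowFlip W u v).measure_preimage
    (measurableSet_restrict_preimage W {v}).nullMeasurableSet]
  congr 1
  ext x
  simp only [mem_preimage, mem_singleton_iff, restrict_windowFlip_eq_iff]

theorem measure_window_ne_zero (W : Finset ℤ) (u : W → Bool) :
    bernoulliMeasure ((W.restrict : CantorZ → W → Bool) ⁻¹' {u}) ≠ 0 := by
  intro h
  have h1 := measure_eq_sum_window W (s := univ)
  simp only [inter_univ, measure_window_eq W _ u, h] at h1
  simp at h1

theorem measure_restrict_preimage (W : Finset ℤ) (s : Finset (W → Bool)) (u : W → Bool) :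
    bernoulliMeasure ((W.restrict : CantorZ → W → Bool) ⁻¹' s) =
      s.card * bernoulliMeasure ((W.restrict : CantorZ → W → Bool) ⁻¹' {u}) := by
  rw [← sum_measure_preimage_singleton s fun v _ => measurableSet_restrict_preimage W {v}]
  simp only [measure_window_eq W _ u, Finset.sum_const, nsmul_eq_mul]

/-- Measure preserving homeomorphisms can be approximated by permutations of the words on a
window. -/
theorem exists_windowPerm_eqOn {σ : CantorZ ≃ₜ CantorZ} (hσ : σ ∈ measurePreservingHomeo)
    (W' : Finset ℤ) : ∃ (W : Finset ℤ) (π : Equiv.Perm (W → Bool)),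
      ∀ i ∈ W', ∀ x, windowPerm W π x i = σ x i := by
  classical
  obtain ⟨W, hW', hW⟩ := σ.continuous.exists_finset_window W'
  let z : CantorZ := fun _ => false
  let f : (W → Bool) → (W' → Bool) := fun u => W'.restrict (σ (windowGlue W u z))
  let p : (W → Bool) → (W' → Bool) := fun u => W'.restrict (windowGlue W u z)
  have hf : ∀ x, f (W.restrict x) = W'.restrict (σ x) := by
    intro x
    ext i
    refine hW _ _ (fun j hj => ?_) i i.2
    rw [windowGlue_of_mem _ _ hj]
    rfl
  have hp : ∀ x : CantorZ, p (W.restrict x) = W'.restrict x := by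
    intro x
    ext i
    change windowGlue W _ _ i = x i
    rw [windowGlue_of_mem _ _ (hW' i.2)]
    rfl
  -- All cylinders over `W` have the same nonzero finite measure, so measure counts words. Since `σ`
  -- preserves measure, the fibres of `f` and `p` have equal size, and some `π` satisfies `p ∘ π =
  -- f`.
  have hcard : ∀ a, Fintype.card {u // f u = a} = Fintype.card {u // p u = a} := by
    intro a
    rw [Fintype.card_subtype, Fintype.card_subtype]
    let u₀ : W → Bool := fun _ => false
    have h1 := measure_restrict_preimage W (Finset.univ.filter fun u => f u = a) u₀
    have h2 := measure_restrict_preimage W (Finset.univ.filter fun u => p u = a) u₀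
    have h3 : (W.restrict : CantorZ → W → Bool) ⁻¹' (Finset.univ.filter fun u => f u = a) =
        σ ⁻¹' ((W.restrict : CantorZ → W → Bool) ⁻¹' (Finset.univ.filter fun u => p u = a)) := by
      ext x
      simp [hf, hp]
    rw [h3, hσ.measure_preimage (measurableSet_restrict_preimage W _).nullMeasurableSet, h2,
      ENNReal.mul_left_inj (measure_window_ne_zero W u₀) (measure_ne_top _ _)] at h1
    exact_mod_cast h1.symm
  let π : Equiv.Perm (W → Bool) :=
    Equiv.ofFiberEquiv (f := f) (g := p) fun a => Fintype.equivOfCardEq (hcard a)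
  refine ⟨W, π, fun i hi x => ?_⟩
  have h1 : p (π (W.restrict x)) = f (W.restrict x) := Equiv.ofFiberEquiv_map _ _
  have h2 : W.restrict (windowPerm W π x) = π (W.restrict x) := restrict_windowGlue _ _ _
  rw [← h2, hp, hf] at h1
  exact congrFun h1 ⟨i, hi⟩

/-- A window permutation alters only digits in `W`. Conjugation by powers of the shift translates
the window, so each fixed digit is eventually left alone, uniformly in the configuration. -/
theorem conjMixing_bernoulliShiftMP : ConjMixing bernoulliShiftMP := by
  refine ConjMixing.of_dense_homoclinic fun σ => mem_closure_iff_nhds.2 fun U hU => ?_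
  obtain ⟨V, hV, hVU⟩ := mem_nhds_subtype _ _ _ |>.1 hU
  obtain ⟨W', hW'⟩ := Homeomorph.exists_finset_of_mem_nhds hV
  obtain ⟨W, π, hπ⟩ := exists_windowPerm_eqOn σ.2 W'
  refine ⟨⟨windowPerm W π, windowPerm_mem W π⟩, hVU (hW' _ hπ), ?_, ?_⟩
  · refine tendsto_subtype_rng.2 (Homeomorph.tendsto_of_eventually_apply_eq fun i => ?_)
    have hinj : Function.Injective fun l : ℕ => i + (l : ℤ) := fun a b hab => by simpa using hab
    have := hinj.tendsto_cofinite.eventually W.finite_toSet.compl_mem_cofinite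
    rw [Nat.cofinite_eq_atTop] at this
    filter_upwards [this] with l hl x
    change (bernoulliShift ^ l) (windowPerm W π ((bernoulliShift ^ l)⁻¹ x)) i = x i
    rw [bernoulliShift_pow_apply]
    refine (windowGlue_of_notMem _ _ hl).trans ?_
    rw [bernoulliShift_pow_inv_apply, add_sub_cancel_right]
  · refine tendsto_subtype_rng.2 (Homeomorph.tendsto_of_eventually_apply_eq fun i => ?_)
    have hinj : Function.Injective fun l : ℕ => i - (l : ℤ) := fun a b hab => by simpa using hab
    have := hinj.tendsto_cofinite.eventually W.finite_toSet.compl_mem_cofinite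
    rw [Nat.cofinite_eq_atTop] at this
    filter_upwards [this] with l hl x
    change (bernoulliShift ^ l)⁻¹ (windowPerm W π ((bernoulliShift ^ l) x)) i = x i
    rw [bernoulliShift_pow_inv_apply]
    refine (windowGlue_of_notMem _ _ hl).trans ?_
    rw [bernoulliShift_pow_apply, sub_add_cancel]

end

theorem mainTheorem8 :
    CyclicallyDenseWithWitness (Equiv.Perm ℤ) intShift ∧
    (∀ q : ℚ, q ≠ 0 → CyclicallyDenseWithWitness (ℚ ≃o ℚ) (ratShift q)) ∧
    CyclicallyDenseWithWitness (CantorZ ≃ₜ CantorZ) bernoulliShift ∧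
    CyclicallyDenseWithWitness measurePreservingHomeo bernoulliShiftMP := by
  exact ⟨conjMixing_intShift.cyclicallyDenseWithWitness noMixedIdentity_intShift,
    fun _ hq => (conjMixing_ratShift hq).cyclicallyDenseWithWitness (noMixedIdentity_ratShift hq),
    conjMixing_bernoulliShift.cyclicallyDenseWithWitness noMixedIdentity_bernoulliShift,
    conjMixing_bernoulliShiftMP.cyclicallyDenseWithWitness noMixedIdentity_bernoulliShiftMP⟩
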